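/- All groups are profinite, homomorphisms are continuous, and subgroups are closed. Let $G$ be a profinite group. Two epimorphisms $\pi\colon H\twoheadrightarrow G$ and $\pi'\colon H'\twoheadrightarrow G$ are isomorphic over $G$, written $\pi\cong_G\pi'$, if there is an isomorphism $\theta\colon H\to H'$ with $\pi'\circ\theta=\pi$. An epimorphism is indecomposable if it is not an isomorphism and whenever it is a composition of two epimorphisms, one of them is an isomorphism. An epimorphism $\pi\colon H\twoheadrightarrow G$ is fundamental if the intersection (taken inside $\operatorname{Ker}\pi$) of all maximal elements of the set of normal subgroups of $H$ strictly contained in $\operatorname{Ker}\pi$ is trivial. If the kernel of an epimorphism onto $G$ is abelian, then it is a $G$-module, with the action induced by conjugation. For a finite simple $G$-module $A$ put $F_A=\operatorname{End}_G(A)$, a finite field, so that $H^2(G,A)$ (continuous cohomology) is an $F_A$-vector space. The relation dimension of a family $(v_i)_{i\in J}$ of vectors of an $F$-vector space $V$ is the dimension of the kernel of the linear map from the $F$-vector space with basis $J$ to $V$ that maps $i$ to $v_i$. Let $\pi\colon H\twoheadrightarrow G$ be an epimorphism. - For an indecomposable $\zeta\colon E\twoheadrightarrow G$ with non-abelian kernel,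 $\operatorname{mult}_\zeta(\pi)$ is the cardinality of the set of normal subgroups $N$ of $H$ with $N\le\operatorname{Ker}\pi$ and $(H/N\twoheadrightarrow G)\cong_G\zeta$. - For a finite simple $G$-module $A$, let $N_A$ be the intersection (taken inside $\operatorname{Ker}\pi$) of all normal subgroups $N\le\operatorname{Ker}\pi$ of $H$ such that the kernel $\operatorname{Ker}(\pi)/N$ of $H/N\twoheadrightarrow G$ is isomorphic to $A$ as a $G$-module. Let $B_A=\operatorname{Ker}(\pi)/N_A$, a profinite $G$-module, and let $f_A\in H^2(G,B_A)$ be the class of the extension $1\to B_A\to H/N_A\to G\to 1$. Let $B_A^*$ be the $F_A$-vector space of continuous $G$-homomorphisms $B_A\to A$, and let $S_A\colon B_A^*\to H^2(G,A)$ be the $F_A$-linear map $\varphi\mapsto\varphi_*(f_A)$. Put $\operatorname{supp}_A(\pi)=\operatorname{Im}S_A$ and $\operatorname{mult}_A(\pi)=\dim_{F_A}\operatorname{Ker}S_A$. **Theorem.** Let $\pi\colon H\twoheadrightarrow G$ be fundamental and let $\eta_I\colon\prod_G H_i\twoheadrightarrow G$ be the structure map of the fiber product over $G$ of a (possibly empty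 or infinite) family of indecomposable epimorphisms $(\eta_i\colon H_i\twoheadrightarrow G)_{i\in I}$; for $I=\emptyset$ it is the identity of $G$. For an indecomposable $\zeta$ onto $G$ with non-abelian kernel let $I_\zeta=\{i\in I \mid \eta_i\cong_G\zeta\}$, and for a finite simple $G$-module $A$ let $I_A=\{i\in I \mid \operatorname{Ker}\eta_i\cong_G A\}$. For all $A$ and $i\in I_A$ choose any $G$-isomorphism $\operatorname{Ker}\eta_i\to A$ and use it to regard $\eta_i$ as an element $[\eta_i]$ of $H^2(G,A)$. Then $\pi\cong_G\eta_I$ if and only if the following three conditions hold: (a) $|I_\zeta|=\operatorname{mult}_\zeta(\pi)$ for every indecomposable epimorphism $\zeta$ onto $G$ with non-abelian kernel; (b) the $F_A$-span of $([\eta_i])_{i\in I_A}$ is $\operatorname{supp}_A(\pi)$, for every finite simple $G$-module $A$; (c) $\operatorname{mult}_A(\pi)$ is the relation dimension of $([\eta_i])_{i\in I_A}$ over $F_A$, for every finite simple $G$-module $A$. -/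

import Mathlib

open Topology

/-- A map `η : E → G` has a continuous section (as a map of sets). -/
def HasContSection {E G : Type*} [TopologicalSpace E] [TopologicalSpace G] (η : E → G) : Prop :=
  ∃ u : G → E, Continuous u ∧ ∀ g, η (u g) = g

/-- Auxiliary notion for the existence of continuous sections: a closed set of representatives
for the fibres of `π`, up to right translation by a subgroup `N` of the kernel. -/
structure IsPartialSection {H G : Type*} [Group H] [TopologicalSpace H] [Group G]
    [TopologicalSpace G] (π : H →ₜ* G) (T : Set H) (N : Subgroup H) : Prop where
  closed : IsClosed T
  surj : ∀ g, ∃ t ∈ T, π t = g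
  le_ker : ∀ n ∈ N, π n = 1
  saturated : ∀ t ∈ T, ∀ n ∈ N, t * n ∈ T
  inj : ∀ x ∈ T, ∀ y ∈ T, π x = π y → x⁻¹ * y ∈ N

theorem IsPartialSection.refine {H G : Type*} [Group H] [TopologicalSpace H]
    [IsTopologicalGroup H] [CompactSpace H] [Group G] [TopologicalSpace G] [T2Space G]
    {π : H →ₜ* G} {T : Set H} {N : Subgroup H} (hT : IsPartialSection π T N)
    (U : OpenNormalSubgroup H) :
    ∃ T' ⊆ T, IsPartialSection π T' (N ⊓ U.toSubgroup) := by
  classical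
  let mk : H → H ⧸ U.toSubgroup := fun h => (h : H ⧸ U.toSubgroup)
  have hmk : Continuous mk := continuous_quot_mk
  have hfin : Finite (H ⧸ U.toSubgroup) :=
    Subgroup.quotient_finite_of_isOpen U.toSubgroup U.isOpen'
  have hdisc : DiscreteTopology (H ⧸ U.toSubgroup) :=
    inferInstanceAs (DiscreteTopology (H ⧸ U.toOpenSubgroup.toSubgroup))
  let C : G → Set (H ⧸ U.toSubgroup) := fun g => {c | ∃ t ∈ T, π t = g ∧ mk t = c}
  have hCclosed : ∀ c, IsClosed {g | c ∈ C g} := by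
    intro c
    have h1 : {g | c ∈ C g} = π '' (T ∩ mk ⁻¹' {c}) := by
      ext g
      constructor
      · rintro ⟨t, ht, hg, hc⟩
        exact ⟨t, ⟨ht, hc⟩, hg⟩
      · rintro ⟨t, ⟨ht, hc⟩, hg⟩
        exact ⟨t, ht, hg, hc⟩
    rw [h1]
    exact ((hT.closed.inter ((isClosed_discrete _).preimage hmk)).isCompact.image
      π.continuous_toFun).isClosed
  have hCopen : ∀ c, IsClosed {g | c ∉ C g} := by
    intro c
    have h1 : {g | c ∉ C g} = π '' (T ∩ (⋃ n ∈ N, (fun t => mk (t * n)) ⁻¹' {c})ᶜ) := by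
      ext g
      constructor
      · intro hg
        obtain ⟨t, ht, rfl⟩ := hT.surj g
        refine ⟨t, ⟨ht, ?_⟩, rfl⟩
        intro hmem
        simp only [Set.mem_iUnion] at hmem
        obtain ⟨n, hn, hc⟩ := hmem
        exact hg ⟨t * n, hT.saturated t ht n hn, by rw [map_mul, hT.le_ker n hn, mul_one], hc⟩
      · rintro ⟨t, ⟨ht, hc⟩, rfl⟩ ⟨s, hs, hst, hsc⟩
        apply hc
        simp only [Set.mem_iUnion]
        refine ⟨t⁻¹ * s, hT.inj t ht s hs hst.symm, ?_⟩
        simpa using hsc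
    rw [h1]
    have hopen : IsOpen (⋃ n ∈ N, (fun t => mk (t * n)) ⁻¹' {c}) := by
      refine isOpen_biUnion fun n _ => ?_
      exact (isOpen_discrete _).preimage (hmk.comp (continuous_mul_const n))
    exact ((hT.closed.inter hopen.isClosed_compl).isCompact.image π.continuous_toFun).isClosed
  have hCeq : ∀ S, IsClosed {g | C g = S} := by
    intro S
    have h1 : {g | C g = S} = ⋂ c, {g | c ∈ C g ↔ c ∈ S} := by
      ext g
      simp [Set.ext_iff]
    rw [h1]
    refine isClosed_iInter fun c => ?_
    by_cases hc : c ∈ S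
    · simpa [hc] using hCclosed c
    · simpa [hc] using hCopen c
  have hF : ∀ S : Set (H ⧸ U.toSubgroup), ∃ c, S.Nonempty → c ∈ S := by
    intro S
    by_cases hS : S.Nonempty
    · exact ⟨hS.some, fun h => hS.some_mem⟩
    · exact ⟨mk 1, fun h => absurd h hS⟩
  choose F hF using hF
  refine ⟨{t | t ∈ T ∧ mk t = F (C (π t))}, fun t ht => ht.1, ?_, ?_, ?_, ?_, ?_⟩
  · have h1 : {t | t ∈ T ∧ mk t = F (C (π t))} =
        ⋃ S : Set (H ⧸ U.toSubgroup), T ∩ (mk ⁻¹' {F S} ∩ π ⁻¹' {g | C g = S}) := by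
      ext t
      simp
    rw [h1]
    exact isClosed_iUnion_of_finite fun S => hT.closed.inter
      (((isClosed_discrete _).preimage hmk).inter ((hCeq S).preimage π.continuous_toFun))
  · intro g
    have hne : (C g).Nonempty := by
      obtain ⟨t, ht, hg⟩ := hT.surj g
      exact ⟨mk t, t, ht, hg, rfl⟩
    obtain ⟨t, ht, hg, hc⟩ := hF _ hne
    exact ⟨t, ⟨ht, by rw [hg, hc]⟩, hg⟩
  · exact fun n hn => hT.le_ker n hn.1
  · rintro t ⟨ht, htc⟩ n hn
    have h1 : π (t * n) = π t := by rw [map_mul, hT.le_ker n hn.1, mul_one]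
    have h2 : mk (t * n) = mk t := (QuotientGroup.eq.2 (by simpa using hn.2)).symm
    exact ⟨hT.saturated t ht n hn.1, by rw [h1, h2, htc]⟩
  · rintro x ⟨hx, hxc⟩ y ⟨hy, hyc⟩ hxy
    refine ⟨hT.inj x hx y hy hxy, ?_⟩
    have : mk x = mk y := by rw [hxc, hyc, hxy]
    exact QuotientGroup.eq.1 this

/-- Every epimorphism of profinite groups has a continuous set-theoretic section. -/
theorem hasContSection_of_surjective {H G : Type*} [Group H] [TopologicalSpace H]
    [IsTopologicalGroup H] [CompactSpace H] [TotallyDisconnectedSpace H]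
    [Group G] [TopologicalSpace G] [T2Space G]
    (π : H →ₜ* G) (hπ : Function.Surjective π) : HasContSection π := by
  classical
  have key : ∃ T, Minimal (· ∈ {T : Set H | ∃ N, IsPartialSection π T N}) T := by
    refine zorn_superset _ fun c hc hchain => ?_
    rcases c.eq_empty_or_nonempty with rfl | hne
    · refine ⟨Set.univ, ⟨π.toMonoidHom.ker, isClosed_univ, fun g => ?_, fun n hn => hn,
        fun _ _ _ _ => Set.mem_univ _, fun x _ y _ hxy => ?_⟩, by simp⟩
      · obtain ⟨t, ht⟩ := hπ g
        exact ⟨t, Set.mem_univ _, ht⟩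
      · change π (x⁻¹ * y) = 1
        rw [map_mul, map_inv, hxy, inv_mul_cancel]
    · have : ∀ T : c, ∃ N, IsPartialSection π T.1 N := fun T => hc T.2
      choose N hN using this
      have : Nonempty c := hne.to_subtype
      refine ⟨⋂₀ c, ⟨⨅ T, N T, isClosed_sInter fun T hT => (hN ⟨T, hT⟩).closed, ?_, ?_, ?_, ?_⟩,
        fun s hs => Set.sInter_subset_of_mem hs⟩
      · intro g
        have hfib : IsClosed (π ⁻¹' {g}) := isClosed_singleton.preimage π.continuous_toFun
        have h := IsCompact.nonempty_iInter_of_directed_nonempty_isCompact_isClosed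
          (fun T : c => T.1 ∩ π ⁻¹' {g}) ?_ ?_ ?_ ?_
        · obtain ⟨t, ht⟩ := h
          rw [Set.mem_iInter] at ht
          exact ⟨t, fun T hT => (ht ⟨T, hT⟩).1, (ht (Classical.arbitrary c)).2⟩
        · intro S T
          rcases hchain.total S.2 T.2 with h | h
          · exact ⟨S, subset_rfl, Set.inter_subset_inter_left _ h⟩
          · exact ⟨T, Set.inter_subset_inter_left _ h, subset_rfl⟩
        · intro T
          obtain ⟨t, ht, hg⟩ := (hN T).surj g
          exact ⟨t, ht, hg⟩
        · exact fun T => ((hN T).closed.inter hfib).isCompact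
        · exact fun T => (hN T).closed.inter hfib
      · intro n hn
        exact (hN (Classical.arbitrary c)).le_ker n (Subgroup.mem_iInf.1 hn _)
      · intro t ht n hn T hT
        exact (hN ⟨T, hT⟩).saturated t (ht T hT) n (Subgroup.mem_iInf.1 hn _)
      · intro x hx y hy hxy
        exact Subgroup.mem_iInf.2 fun T => (hN T).inj x (hx _ T.2) y (hy _ T.2) hxy
  obtain ⟨T, ⟨N, hT⟩, hmin⟩ := key
  have hinj : Function.Injective (fun t : T => π t.1) := by
    rintro ⟨x, hx⟩ ⟨y, hy⟩ hxy
    by_contra hne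
    have hne' : x⁻¹ * y ≠ 1 := by
      intro h
      exact hne (Subtype.ext (inv_mul_eq_one.1 h))
    obtain ⟨U, hU⟩ := ProfiniteGrp.exist_openNormalSubgroup_sub_open_nhds_of_one
      (isOpen_compl_singleton (x := x⁻¹ * y)) (by simpa using hne'.symm)
    obtain ⟨T', hT'T, hT'⟩ := hT.refine U
    have hTT' : T ⊆ T' := hmin ⟨_, hT'⟩ hT'T
    have : x⁻¹ * y ∈ U.toSubgroup := (hT'.inj x (hTT' hx) y (hTT' hy) hxy).2
    exact hU this rfl
  have hsurj : Function.Surjective (fun t : T => π t.1) := by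
    intro g
    obtain ⟨t, ht, hg⟩ := hT.surj g
    exact ⟨⟨t, ht⟩, hg⟩
  have : CompactSpace T := isCompact_iff_compactSpace.1 hT.closed.isCompact
  let e : T ≃ G := Equiv.ofBijective _ ⟨hinj, hsurj⟩
  have he : Continuous e := π.continuous_toFun.comp continuous_subtype_val
  let e' : T ≃ₜ G := he.homeoOfEquivCompactToT2
  exact ⟨fun g => (e'.symm g).1, continuous_subtype_val.comp e'.symm.continuous,
    fun g => e'.apply_symm_apply g⟩

universe u

section Covers

/-- Two homomorphisms `π : H → G` and `π' : H' → G` are isomorphic over `G`. -/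
def IsoOver {H H' G : Type*} [Group H] [TopologicalSpace H] [Group H'] [TopologicalSpace H']
    [Group G] [TopologicalSpace G] (π : H →ₜ* G) (π' : H' →ₜ* G) : Prop :=
  ∃ e : H ≃ₜ* H', ∀ h, π' (e h) = π h

/-- An indecomposable epimorphism of profinite groups. (A bijective continuous homomorphism of
profinite groups is an isomorphism.) -/
def IsIndecomposable {H G : ProfiniteGrp.{u}} (φ : H →ₜ* G) : Prop :=
  Function.Surjective φ ∧ ¬ Function.Bijective φ ∧
    ∀ (E : ProfiniteGrp.{u}) (ψ : H →ₜ* E) (ρ : E →ₜ* G),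
      Function.Surjective ψ → Function.Surjective ρ → (∀ h, φ h = ρ (ψ h)) →
        Function.Bijective ψ ∨ Function.Bijective ρ

/-- The closed normal subgroups of `H` strictly contained in `M`. -/
def closedNormalBelow {H : Type*} [Group H] [TopologicalSpace H] (M : Subgroup H) :
    Set (Subgroup H) :=
  {N | N.Normal ∧ IsClosed (N : Set H) ∧ N < M}

/-- The maximal ones among the closed normal subgroups of `H` strictly contained in `M`. -/
def maxNormalBelow {H : Type*} [Group H] [TopologicalSpace H] (M : Subgroup H) :
    Set (Subgroup H) :=
  {N | Maximal (· ∈ closedNormalBelow M) N}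

/-- The fundament kernel of `π`. The intersection is taken among subgroups of `Ker π`: if there is
no `N`, which happens only for `Ker π = 1`, it is `Ker π`. -/
def fundamentKernel {H G : Type*} [Group H] [TopologicalSpace H] [Group G] [TopologicalSpace G]
    (π : H →ₜ* G) : Subgroup H :=
  π.toMonoidHom.ker ⊓ sInf (maxNormalBelow π.toMonoidHom.ker)

/-- A fundamental epimorphism. -/
def IsFundamental {H G : Type*} [Group H] [TopologicalSpace H] [Group G] [TopologicalSpace G]
    (π : H →ₜ* G) : Prop :=
  Function.Surjective π ∧ fundamentKernel π = ⊥

/-- The homomorphism `H/N → G` induced by `π : H → G`, for `N ≤ Ker π`. -/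
def quotientCover {H G : Type*} [Group H] [TopologicalSpace H] [Group G] [TopologicalSpace G]
    (π : H →ₜ* G) (N : Subgroup H) [N.Normal] (hN : N ≤ π.toMonoidHom.ker) : H ⧸ N →ₜ* G where
  toMonoidHom := QuotientGroup.lift N π.toMonoidHom hN
  continuous_toFun := π.continuous_toFun.quotient_lift _

/-- The fiber product over `G` of a family `η i : H i → G`. The coordinate in `G` is the common
value of the `η i (h i)`; it is redundant unless the family is empty, when the fiber product
is `G`. -/
def fiberProduct {G : Type*} {I : Type*} {H : I → Type*} [Group G] [TopologicalSpace G]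
    [∀ i, Group (H i)] [∀ i, TopologicalSpace (H i)] (η : ∀ i, H i →ₜ* G) :
    Subgroup (G × ∀ i, H i) where
  carrier := {x | ∀ i, η i (x.2 i) = x.1}
  one_mem' := fun i => map_one (η i)
  mul_mem' := fun {x y} hx hy i => by
    change η i (x.2 i * y.2 i) = x.1 * y.1
    rw [map_mul, hx i, hy i]
  inv_mem' := fun {x} hx i => by
    change η i (x.2 i)⁻¹ = x.1⁻¹
    rw [map_inv, hx i]

/-- The structure map `η_I` of the fiber product. -/
def fiberProductMap {G : Type*} {I : Type*} {H : I → Type*} [Group G] [TopologicalSpace G]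
    [∀ i, Group (H i)] [∀ i, TopologicalSpace (H i)] (η : ∀ i, H i →ₜ* G) :
    fiberProduct η →ₜ* G where
  toMonoidHom := (MonoidHom.fst G (∀ i, H i)).comp (fiberProduct η).subtype
  continuous_toFun := continuous_fst.comp continuous_subtype_val

/-- For an epimorphism `π : H → G` and an indecomposable `ζ : E → G`, the set `𝒞_ζ` of closed normal
subgroups `N ≤ Ker π` of `H` with `H/N → G` isomorphic to `ζ`. -/
def coverQuotients {H G E : Type*} [Group H] [TopologicalSpace H] [Group G] [TopologicalSpace G]
    [Group E] [TopologicalSpace E] (π : H →ₜ* G) (ζ : E →ₜ* G) : Set (Subgroup H) :=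
  {N | ∃ (_ : N.Normal) (hN : N ≤ π.toMonoidHom.ker), IsClosed (N : Set H) ∧
    IsoOver (quotientCover π N hN) ζ}

/-- The `ζ`-multiplicity of `π`. -/
noncomputable def coverMult {H : Type u} {G E : Type*} [Group H] [TopologicalSpace H] [Group G]
    [TopologicalSpace G] [Group E] [TopologicalSpace E] (π : H →ₜ* G) (ζ : E →ₜ* G) :
    Cardinal.{u} :=
  Cardinal.mk (coverQuotients π ζ)

end Covers

section Modules

/-- A finite simple (discrete) `G`-module. -/
structure SimpleGModule (G : Type u) [Group G] [TopologicalSpace G] where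
  carrier : Type u
  [addCommGroup : AddCommGroup carrier]
  [action : DistribMulAction G carrier]
  [topologicalSpace : TopologicalSpace carrier]
  [discrete : DiscreteTopology carrier]
  [continuousSMul : ContinuousSMul G carrier]
  [finite : Finite carrier]
  [nontrivial : Nontrivial carrier]
  simple : ∀ B : AddSubgroup carrier, (∀ (g : G), ∀ b ∈ B, g • b ∈ B) → B = ⊥ ∨ B = ⊤

attribute [instance] SimpleGModule.addCommGroup SimpleGModule.action
  SimpleGModule.topologicalSpace SimpleGModule.discrete SimpleGModule.continuousSMul
  SimpleGModule.finite SimpleGModule.nontrivial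

instance {G : Type u} [Group G] [TopologicalSpace G] :
    CoeSort (SimpleGModule G) (Type u) := ⟨SimpleGModule.carrier⟩

variable {G : Type u} [Group G] [TopologicalSpace G]

/-- `F_A = End_G(A)`, the ring (in fact a finite field) of `G`-endomorphisms of `A`. It acts on `A`
by evaluation. -/
def endG (A : SimpleGModule G) : Subring (AddMonoid.End A) where
  carrier := {f | ∀ (g : G) (a : A), f (g • a) = g • f a}
  zero_mem' := fun g _ => (smul_zero g).symm
  one_mem' := fun _ _ => rfl
  add_mem' := fun {x y} hx hy g a => by
    change x (g • a) + y (g • a) = g • (x a + y a)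
    rw [hx, hy, smul_add]
  mul_mem' := fun {x y} hx hy g a => by
    change x (y (g • a)) = g • x (y a)
    rw [hy, hx]
  neg_mem' := fun {x} hx g a => by
    change -x (g • a) = g • (-x a)
    rw [hx, smul_neg]

theorem endG_smul_comm (A : SimpleGModule G) (α : endG A) (g : G) (a : A) :
    α • (g • a) = g • (α • a) :=
  α.2 g a

theorem continuous_endG_smul (A : SimpleGModule G) {X : Type*} [TopologicalSpace X] (α : endG A)
    {f : X → A} (hf : Continuous f) : Continuous (fun x => α • f x) :=
  (continuous_of_discreteTopology (f := fun a : A => α • a)).comp hf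

/-- The continuous (non-homogeneous) 2-cocycles of `G` with values in `A`. -/
def cocycles2 (A : SimpleGModule G) : Submodule (endG A) (G × G → A) where
  carrier := {f | Continuous f ∧
    ∀ σ τ ρ : G, σ • f (τ, ρ) - f (σ * τ, ρ) + f (σ, τ * ρ) - f (σ, τ) = 0}
  zero_mem' := ⟨continuous_const, fun σ τ ρ => by simp⟩
  add_mem' := fun {x y} hx hy => ⟨hx.1.add hy.1, fun σ τ ρ => by
    have h := congrArg₂ (· + ·) (hx.2 σ τ ρ) (hy.2 σ τ ρ)
    simp only [Pi.add_apply, smul_add, add_zero] at h ⊢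
    rw [← h]
    abel⟩
  smul_mem' := fun α x hx => ⟨continuous_endG_smul A α hx.1, fun σ τ ρ => by
    have h := congrArg (α • ·) (hx.2 σ τ ρ)
    simpa only [Pi.smul_apply, smul_sub, smul_add, smul_zero, endG_smul_comm] using h⟩

/-- The continuous 2-coboundaries of `G` with values in `A`. -/
def coboundaries2 (A : SimpleGModule G) : Submodule (endG A) (G × G → A) where
  carrier := {f | ∃ c : G → A, Continuous c ∧
    ∀ σ τ : G, f (σ, τ) = σ • c τ - c (σ * τ) + c σ}
  zero_mem' := ⟨0, continuous_const, fun σ τ => by simp⟩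
  add_mem' := by
    rintro x y ⟨c, hc, hx⟩ ⟨d, hd, hy⟩
    refine ⟨c + d, hc.add hd, fun σ τ => ?_⟩
    simp only [Pi.add_apply, smul_add, hx, hy]
    abel
  smul_mem' := by
    rintro α x ⟨c, hc, hx⟩
    refine ⟨α • c, continuous_endG_smul A α hc, fun σ τ => ?_⟩
    simp only [Pi.smul_apply, hx, smul_sub, smul_add, endG_smul_comm]

/-- `H²(G, A)`, as a vector space over `F_A`. -/
abbrev H2 (A : SimpleGModule G) : Type u :=
  cocycles2 A ⧸ (coboundaries2 A).submoduleOf (cocycles2 A)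

variable {E : Type u} [Group E] [TopologicalSpace E]

/-- The continuous `G`-homomorphisms from the kernel of `η : E → G` to `A`, where `G` acts on
the kernel through conjugation in `E`; this is the `F_A`-vector space `(Ker η)^*`. -/
def kerDual (η : E →ₜ* G) (A : SimpleGModule G) :
    Submodule (endG A) (η.toMonoidHom.ker → A) where
  carrier := {φ | Continuous φ ∧ (∀ x y, φ (x * y) = φ x + φ y) ∧
    ∀ (h : E) (x : η.toMonoidHom.ker),
      φ ⟨h * x * h⁻¹, (inferInstance : η.toMonoidHom.ker.Normal).conj_mem x x.2 h⟩ = η h • φ x}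
  zero_mem' := ⟨continuous_const, fun x y => by simp, fun h x => by simp⟩
  add_mem' := fun {φ ψ} hφ hψ => ⟨hφ.1.add hψ.1,
    fun x y => by
      simp only [Pi.add_apply, hφ.2.1, hψ.2.1]
      abel,
    fun h x => by simp only [Pi.add_apply, hφ.2.2, hψ.2.2, smul_add]⟩
  smul_mem' := fun α φ hφ => ⟨continuous_endG_smul A α hφ.1,
    fun x y => by simp only [Pi.smul_apply, hφ.2.1, smul_add],
    fun h x => by simp only [Pi.smul_apply, hφ.2.2, endG_smul_comm]⟩

/-- The `G`-isomorphisms from the kernel of `η : E → G` to `A`. If there is one, then the kernel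
is finite and abelian (and discrete, if `E` is Hausdorff). -/
def KerIso (η : E →ₜ* G) (A : SimpleGModule G) : Type u :=
  {φ : kerDual η A // Function.Bijective φ.1}

/-- The index set `I_A` of those `i` for which `Ker (η i)` is isomorphic to `A` as a `G`-module. -/
abbrev kerIndex {I : Type u} {K : I → Type u} [∀ i, Group (K i)] [∀ i, TopologicalSpace (K i)]
    (η : ∀ i, K i →ₜ* G) (A : SimpleGModule G) : Type u :=
  {i : I // Nonempty (KerIso (η i) A)}

/-- The factor set `(σ, τ) ↦ u(σ) u(τ) u(στ)⁻¹` of a section `u` of `η`. -/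
def factorSet (η : E →ₜ* G) (u : G → E) (hu : ∀ g, η (u g) = g) (p : G × G) :
    η.toMonoidHom.ker :=
  ⟨u p.1 * u p.2 * (u (p.1 * p.2))⁻¹, by
    change η _ = 1
    rw [map_mul, map_mul, map_inv, hu, hu, hu, mul_inv_cancel]⟩

theorem comp_factorSet_mem [IsTopologicalGroup E] [IsTopologicalGroup G] (η : E →ₜ* G)
    (A : SimpleGModule G) (u : G → E) (huc : Continuous u) (hu : ∀ g, η (u g) = g)
    (φ : kerDual η A) : (fun p => φ.1 (factorSet η u hu p)) ∈ cocycles2 A := by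
  refine ⟨φ.2.1.comp (Continuous.subtype_mk (by fun_prop) _), fun σ τ ρ => ?_⟩
  have h1 := φ.2.2.2 (u σ) (factorSet η u hu (τ, ρ))
  rw [hu] at h1
  have h2 : (⟨u σ * factorSet η u hu (τ, ρ) * (u σ)⁻¹,
      (inferInstance : η.toMonoidHom.ker.Normal).conj_mem _ (factorSet η u hu (τ, ρ)).2 (u σ)⟩ :
        η.toMonoidHom.ker) * factorSet η u hu (σ, τ * ρ) =
      factorSet η u hu (σ, τ) * factorSet η u hu (σ * τ, ρ) := by
    apply Subtype.ext
    simp only [factorSet, Subgroup.coe_mul, mul_assoc]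
    group
  have h3 := congrArg φ.1 h2
  rw [φ.2.2.1, φ.2.2.1, h1] at h3
  have h4 : σ • φ.1 (factorSet η u hu (τ, ρ)) =
      φ.1 (factorSet η u hu (σ, τ)) + φ.1 (factorSet η u hu (σ * τ, ρ)) -
        φ.1 (factorSet η u hu (σ, τ * ρ)) := eq_sub_of_add_eq h3
  simp only [h4]
  abel

/-- The `F_A`-linear map `φ ↦ φ_* f` from `(Ker η)^*` to `H²(G, A)`, where `f` is the class of the
extension `1 → Ker η → E → G → 1`, represented by the factor set of a continuous section.
(The class `φ_* f` does not depend on the section.) -/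
noncomputable def extMap [IsTopologicalGroup E] [IsTopologicalGroup G] (η : E →ₜ* G)
    (hη : HasContSection η) (A : SimpleGModule G) : kerDual η A →ₗ[endG A] H2 A :=
  ((coboundaries2 A).submoduleOf (cocycles2 A)).mkQ ∘ₗ
    { toFun := fun φ => ⟨fun p => φ.1 (factorSet η hη.choose hη.choose_spec.2 p),
        comp_factorSet_mem η A hη.choose hη.choose_spec.1 hη.choose_spec.2 φ⟩
      map_add' := fun _ _ => rfl
      map_smul' := fun _ _ => rfl }

/-- For an epimorphism `π : H → G`, the set `𝒞_A` of closed normal subgroups `N ≤ Ker π` of `H` such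
that the kernel of `H/N → G` is isomorphic to `A` as a `G`-module. -/
def moduleQuotients {H : Type u} [Group H] [TopologicalSpace H] (π : H →ₜ* G)
    (A : SimpleGModule G) : Set (Subgroup H) :=
  {N | ∃ (_ : N.Normal) (hN : N ≤ π.toMonoidHom.ker), IsClosed (N : Set H) ∧
    Nonempty (KerIso (quotientCover π N hN) A)}

/-- The intersection `N_A` of all `N ∈ 𝒞_A`, among subgroups of `Ker π` (so it is `Ker π` if `𝒞_A` is
empty). -/
def moduleKernel {H : Type u} [Group H] [TopologicalSpace H] (π : H →ₜ* G)
    (A : SimpleGModule G) : Subgroup H :=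
  π.toMonoidHom.ker ⊓ sInf (moduleQuotients π A)

theorem moduleKernel_le {H : Type u} [Group H] [TopologicalSpace H] (π : H →ₜ* G)
    (A : SimpleGModule G) : moduleKernel π A ≤ π.toMonoidHom.ker :=
  inf_le_left

instance moduleKernel_normal {H : Type u} [Group H] [TopologicalSpace H] (π : H →ₜ* G)
    (A : SimpleGModule G) : (moduleKernel π A).Normal := by
  have h : (sInf (moduleQuotients π A)).Normal := by
    refine ⟨fun x hx g => ?_⟩
    rw [Subgroup.mem_sInf] at hx ⊢
    intro N hN
    exact hN.1.conj_mem x (hx N hN) g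
  exact Subgroup.normal_inf_normal _ _

/-- The epimorphism `π_A : H_A = H/N_A → G` induced by `π`. -/
def moduleCover {H : Type u} [Group H] [TopologicalSpace H] (π : H →ₜ* G)
    (A : SimpleGModule G) : H ⧸ moduleKernel π A →ₜ* G :=
  quotientCover π (moduleKernel π A) (moduleKernel_le π A)

end Modules

section Invariants

variable {G H : ProfiniteGrp.{u}}

theorem hasContSection_moduleCover (π : H →ₜ* G) (hπ : Function.Surjective π)
    (A : SimpleGModule G) : HasContSection (moduleCover π A) := by
  obtain ⟨s, hs, hsec⟩ := hasContSection_of_surjective π hπ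
  exact ⟨fun g => (s g : H ⧸ moduleKernel π A), continuous_quot_mk.comp hs, hsec⟩

/-- The linear map `S_A : B_A^* → H²(G, A)`, `φ ↦ φ_* f_A`, where `B_A = Ker π_A` and `f_A` is the class
of the extension `1 → B_A → H_A → G → 1`. -/
noncomputable def moduleMap (π : H →ₜ* G) (hπ : Function.Surjective π) (A : SimpleGModule G) :
    kerDual (moduleCover π A) A →ₗ[endG A] H2 A :=
  extMap (moduleCover π A) (hasContSection_moduleCover π hπ A) A

/-- The `A`-support of `π`. -/
noncomputable def moduleSupp (π : H →ₜ* G) (hπ : Function.Surjective π) (A : SimpleGModule G) :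
    Submodule (endG A) (H2 A) :=
  LinearMap.range (moduleMap π hπ A)

/-- The `A`-multiplicity of `π`. -/
noncomputable def moduleMult (π : H →ₜ* G) (hπ : Function.Surjective π) (A : SimpleGModule G) :
    Cardinal.{u} :=
  Module.rank (endG A) (LinearMap.ker (moduleMap π hπ A))

/-- The relation dimension of a family of vectors. -/
noncomputable def relationDim (F : Type u) {V I : Type u} [Ring F] [AddCommGroup V] [Module F V]
    (v : I → V) : Cardinal.{u} :=
  Module.rank F (LinearMap.ker (Finsupp.linearCombination F v))

/-- The class in `H²(G, A)` of an extension `η` of `G` whose kernel is identified with `A`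
through `e`. -/
noncomputable def extClass (η : H →ₜ* G) (hη : Function.Surjective η) {A : SimpleGModule G}
    (e : KerIso η A) : H2 A :=
  extMap η (hasContSection_of_surjective η hη) A e.1

end Invariants

/-! ### Profinite quotients and isomorphisms over G -/

section Profinite

/-! An isomorphism of `π` with the fiber product is a family of epimorphisms `f i : H → K i` over
`G` that is independent (every compatible choice of values is attained) and jointly injective. The
proof translates the existence of such a family into multiplicities. The basic tool is that `Ker (η
i)` is minimal normal, so a closed normal subgroup of `H` inside `Ker π` is mapped by `f i` either
to 1 or onto `Ker (η i)`.

Factors with non-abelian kernel behave like points of a set. If a non-abelian indecomposable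
quotient is trivial on a finite intersection of kernels, then a commutator argument shows that it is
trivial on one of them and has the same kernel (`IsIndecomposable.exists_of_trivial_on_jointKernel`,
`IsIndecomposable.ker_eq_of_le`). Hence only the number of quotients in each isomorphism class
matters.

Factors with kernel `A` behave like vectors of the dual `(Ker π)^*`, the space of continuous
`G`-homomorphisms from `Ker π` to `A`. A `φ` in it comes from a homomorphism to `K i` over `G` as
soon as it sends the class of `π` to the class of `η i` (`exists_hom_of_extMap_eq`), and an element
trivial on a finite intersection of kernels is a linear combination of those induced by the factors
(`mem_span_of_trivial_on_jointKernel`). So the right choices of the `f i` correspond to bases of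
`(Ker π)^*` that lift the family of classes. Such a basis exists exactly if the classes span the
image of `S_A` and have as many independent relations as `S_A` has kernel
(`exists_basis_of_range_eq`, `range_and_rank_of_basis`).

Fundamentality gives joint injectivity: each maximal `N` below `Ker π` defines an indecomposable
quotient, which is controlled by the `f i`, and these `N` intersect trivially. Compactness carries
the finite statements over to infinite families. -/

theorem totallyDisconnectedSpace_quotient {H : Type*} [Group H] [TopologicalSpace H]
    [IsTopologicalGroup H] [CompactSpace H] [TotallyDisconnectedSpace H] (N : Subgroup H)
    [N.Normal] (hN : IsClosed (N : Set H)) : TotallyDisconnectedSpace (H ⧸ N) := by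
  have hsep : ∀ q : H ⧸ N, q ≠ 1 → ∃ V : Subgroup (H ⧸ N), IsOpen (V : Set (H ⧸ N)) ∧ q ∉ V := by
    intro q hq
    obtain ⟨x, rfl⟩ := QuotientGroup.mk_surjective q
    have hx : x ∉ N := fun h => hq ((QuotientGroup.eq_one_iff x).2 h)
    -- An open normal `U` with `xU` disjoint from `N` has an open image in `H/N` that misses the
    -- class of `x`.
    have hO : IsOpen ((fun h => x * h) ⁻¹' (N : Set H)ᶜ) :=
      hN.isOpen_compl.preimage (continuous_const_mul x)
    obtain ⟨U, hU⟩ := ProfiniteGrp.exist_openNormalSubgroup_sub_open_nhds_of_one hO (by simpa using hx)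
    refine ⟨U.toSubgroup.map (QuotientGroup.mk' N), ?_, ?_⟩
    · exact QuotientGroup.isOpenMap_coe (N := N) _ U.isOpen'
    · rintro ⟨v, hv, hvx⟩
      have h1 : x⁻¹ * v ∈ N := QuotientGroup.eq.1 hvx.symm
      have h2 : v⁻¹ * x ∈ N := by simpa using N.inv_mem h1
      have h3 : x * v⁻¹ ∈ N := (inferInstance : N.Normal).mem_comm h2
      exact hU (U.toSubgroup.inv_mem hv) h3
  have : TotallySeparatedSpace (H ⧸ N) := by
    refine totallySeparatedSpace_iff_exists_isClopen.2 fun a b hab => ?_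
    obtain ⟨V, hV, hq⟩ := hsep (a⁻¹ * b) (fun h => hab (inv_mul_eq_one.1 h))
    refine ⟨(fun c => a⁻¹ * c) ⁻¹' (V : Set (H ⧸ N)), ?_, ?_, ?_⟩
    · exact IsClopen.preimage ⟨V.isClosed_of_isOpen hV, hV⟩ (continuous_const_mul _)
    · simp [V.one_mem]
    · exact hq
  infer_instance

/-- The quotient of a profinite group by a closed normal subgroup. -/
def profiniteQuotient (H : ProfiniteGrp.{u}) (N : Subgroup H) [N.Normal]
    (hN : IsClosed (N : Set H)) : ProfiniteGrp.{u} :=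
  haveI := totallyDisconnectedSpace_quotient N hN
  haveI : IsClosed (N : Set H) := hN
  ProfiniteGrp.of (H ⧸ N)

theorem isClosed_ker {H G : Type*} [Group H] [TopologicalSpace H] [Group G] [TopologicalSpace G]
    [T1Space G] (f : H →ₜ* G) : IsClosed (f.toMonoidHom.ker : Set H) :=
  isClosed_singleton.preimage f.continuous_toFun

/-- Two epimorphisms with the same kernel have isomorphic targets over `G`. -/
theorem isoOver_of_ker_eq {H K E G : Type*} [Group H] [TopologicalSpace H] [CompactSpace H]
    [Group K] [TopologicalSpace K] [T2Space K] [Group E] [TopologicalSpace E] [T2Space E]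
    [Group G] [TopologicalSpace G] {η : K →ₜ* G} {ζ : E →ₜ* G} (f : H →ₜ* K) (g : H →ₜ* E)
    (hf : Function.Surjective f) (hg : Function.Surjective g) (hfg : ∀ x, f x = 1 ↔ g x = 1)
    (hcomp : ∀ h, η (f h) = ζ (g h)) : IsoOver η ζ := by
  have hker : f.toMonoidHom.ker = g.toMonoidHom.ker := Subgroup.ext hfg
  let a : K ≃* E := (QuotientGroup.quotientKerEquivOfSurjective f.toMonoidHom hf).symm.trans
    ((QuotientGroup.quotientMulEquivOfEq hker).trans
      (QuotientGroup.quotientKerEquivOfSurjective g.toMonoidHom hg))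
  have ha : ∀ h, a (f h) = g h := by
    intro h
    have h1 : (QuotientGroup.quotientKerEquivOfSurjective f.toMonoidHom hf).symm (f h) =
        QuotientGroup.mk h := by
      rw [MulEquiv.symm_apply_eq]
      rfl
    simp only [a, MulEquiv.trans_apply]
    rw [h1]
    rfl
  refine ⟨⟨a, ?_, ?_⟩, ?_⟩
  · change Continuous a
    -- A continuous surjection from a compact to a Hausdorff space is a quotient map, so continuity
    -- can be tested on `H`.
    rw [(f.continuous_toFun.isClosedMap.isQuotientMap f.continuous_toFun hf).continuous_iff]
    exact g.continuous_toFun.congr fun h => (ha h).symm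
  · change Continuous a.symm
    rw [(g.continuous_toFun.isClosedMap.isQuotientMap g.continuous_toFun hg).continuous_iff]
    refine f.continuous_toFun.congr fun h => ?_
    exact ((MulEquiv.symm_apply_eq a).2 (ha h).symm).symm
  · intro k
    obtain ⟨h, rfl⟩ := hf k
    change ζ (a (f h)) = _
    rw [ha, hcomp]

theorem IsoOver.refl {H G : Type*} [Group H] [TopologicalSpace H] [Group G] [TopologicalSpace G]
    (π : H →ₜ* G) : IsoOver π π :=
  ⟨ContinuousMulEquiv.refl H, fun _ => rfl⟩

theorem IsoOver.symm {H H' G : Type*} [Group H] [TopologicalSpace H] [Group H']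
    [TopologicalSpace H'] [Group G] [TopologicalSpace G] {π : H →ₜ* G} {π' : H' →ₜ* G}
    (h : IsoOver π π') : IsoOver π' π := by
  obtain ⟨e, he⟩ := h
  exact ⟨e.symm, fun x => by rw [← he, e.apply_symm_apply]⟩

theorem IsoOver.trans {H H' H'' G : Type*} [Group H] [TopologicalSpace H] [Group H']
    [TopologicalSpace H'] [Group H''] [TopologicalSpace H''] [Group G] [TopologicalSpace G]
    {π : H →ₜ* G} {π' : H' →ₜ* G} {π'' : H'' →ₜ* G}
    (h : IsoOver π π') (h' : IsoOver π' π'') : IsoOver π π'' := by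
  obtain ⟨e, he⟩ := h
  obtain ⟨e', he'⟩ := h'
  exact ⟨e.trans e', fun x => by rw [ContinuousMulEquiv.trans_apply, he', he]⟩

theorem quotientCover_surjective {H G : Type*} [Group H] [TopologicalSpace H] [Group G]
    [TopologicalSpace G] {π : H →ₜ* G} (hπ : Function.Surjective π) (N : Subgroup H) [N.Normal]
    (hN : N ≤ π.toMonoidHom.ker) : Function.Surjective (quotientCover π N hN) := fun g => by
  obtain ⟨h, rfl⟩ := hπ g
  exact ⟨(h : H ⧸ N), rfl⟩

/-- This replaces quotient groups by epimorphisms `H → E` over `G`, which are easier to compose and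
compare; the quotient is recovered as the kernel. -/
theorem mem_coverQuotients_iff {H E G : Type*} [Group H] [TopologicalSpace H]
    [IsTopologicalGroup H] [CompactSpace H]
    [Group E] [TopologicalSpace E] [T2Space E] [Group G] [TopologicalSpace G]
    {π : H →ₜ* G} {ζ : E →ₜ* G} {N : Subgroup H} :
    N ∈ coverQuotients π ζ ↔ ∃ g : H →ₜ* E, Function.Surjective g ∧ (∀ h, ζ (g h) = π h) ∧
      g.toMonoidHom.ker = N := by
  constructor
  · rintro ⟨hn, hN, hc, e, he⟩
    refine ⟨⟨e.toMulEquiv.toMonoidHom.comp (QuotientGroup.mk' N),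
      e.continuous_toFun.comp continuous_quot_mk⟩,
      e.surjective.comp QuotientGroup.mk_surjective, fun h => he _, ?_⟩
    ext x
    change e (x : H ⧸ N) = 1 ↔ _
    rw [← map_one e, e.apply_eq_iff_eq, QuotientGroup.eq_one_iff]
  · rintro ⟨g, hg, hcomp, rfl⟩
    have hc := isClosed_ker g
    have hle : g.toMonoidHom.ker ≤ π.toMonoidHom.ker := by
      intro x hx
      have hx' : g x = 1 := hx
      change π x = 1
      rw [← hcomp, hx', map_one]
    have : IsClosed (g.toMonoidHom.ker : Set H) := hc
    refine ⟨inferInstance, hle, hc, isoOver_of_ker_eq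
      ⟨QuotientGroup.mk' g.toMonoidHom.ker, continuous_quot_mk⟩ g QuotientGroup.mk_surjective hg
      (fun x => QuotientGroup.eq_one_iff x) fun h => (hcomp h).symm⟩

end Profinite

/-! ### Indecomposable covers and minimal normal kernels -/

section Indecomposable

variable {G H E : ProfiniteGrp.{u}}

/-- The factorization `E → E/N → G` must have a bijective factor. -/
theorem IsIndecomposable.eq_bot_or_eq_ker {ζ : E →ₜ* G} (hζ : IsIndecomposable ζ)
    (N : Subgroup E) [N.Normal] (hc : IsClosed (N : Set E)) (hN : N ≤ ζ.toMonoidHom.ker) :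
    N = ⊥ ∨ N = ζ.toMonoidHom.ker := by
  rcases hζ.2.2 (profiniteQuotient E N hc) ⟨QuotientGroup.mk' N, continuous_quot_mk⟩
    (quotientCover ζ N hN) QuotientGroup.mk_surjective
    (quotientCover_surjective hζ.1 N hN) (fun _ => rfl) with h | h
  · left
    refine (Subgroup.eq_bot_iff_forall _).2 fun x hx => h.1 ?_
    exact ((QuotientGroup.eq_one_iff x).2 hx).trans (map_one _).symm
  · right
    refine le_antisymm hN fun x hx => ?_
    refine (QuotientGroup.eq_one_iff x).1 (h.1 ?_)
    exact hx.trans (map_one (quotientCover ζ N hN)).symm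

theorem IsIndecomposable.exists_ker_ne_one {ζ : E →ₜ* G} (hζ : IsIndecomposable ζ) :
    ∃ x, ζ x = 1 ∧ x ≠ 1 := by
  by_contra! h
  exact hζ.2.1 ⟨(injective_iff_map_eq_one ζ).2 h, hζ.1⟩

theorem isIndecomposable_of_minimal {ζ : E →ₜ* G} (hs : Function.Surjective ζ)
    (hb : ∃ x, ζ x = 1 ∧ x ≠ 1)
    (hmin : ∀ N : Subgroup E, N.Normal → IsClosed (N : Set E) → N ≤ ζ.toMonoidHom.ker →
      N = ⊥ ∨ N = ζ.toMonoidHom.ker) : IsIndecomposable ζ := by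
  refine ⟨hs, fun h => ?_, fun F ψ ρ hψ hρ hcomp => ?_⟩
  · obtain ⟨x, hx, hx1⟩ := hb
    exact hx1 (h.1 (hx.trans (map_one ζ).symm))
  · rcases hmin ψ.toMonoidHom.ker inferInstance (isClosed_ker ψ) (fun x hx => by
      have hx' : ψ x = 1 := hx
      change ζ x = 1
      rw [hcomp, hx', map_one]) with h | h
    · exact Or.inl ⟨(injective_iff_map_eq_one ψ).2 fun x hx =>
        (Subgroup.eq_bot_iff_forall _).1 h x hx, hψ⟩
    · refine Or.inr ⟨(injective_iff_map_eq_one ρ).2 fun y hy => ?_, hρ⟩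
      obtain ⟨x, rfl⟩ := hψ y
      have : x ∈ ψ.toMonoidHom.ker := by
        rw [h]
        exact (hcomp x).trans hy
      exact this

/-- The image of a closed normal subgroup of `Ker π` in an indecomposable quotient. -/
theorem IsIndecomposable.image_trivial_or_full {ζ : E →ₜ* G} (hζ : IsIndecomposable ζ)
    {π : H →ₜ* G} (g : H →ₜ* E) (hg : Function.Surjective g) (hcomp : ∀ h, ζ (g h) = π h)
    (L : Subgroup H) [hn : L.Normal] (hc : IsClosed (L : Set H)) (hL : L ≤ π.toMonoidHom.ker) :
    (∀ x ∈ L, g x = 1) ∨ ∀ y, ζ y = 1 → ∃ x ∈ L, g x = y := by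
  have : (L.map g.toMonoidHom).Normal := hn.map _ hg
  rcases hζ.eq_bot_or_eq_ker (L.map g.toMonoidHom)
    (hc.isCompact.image g.continuous_toFun).isClosed (by
      rintro _ ⟨x, hx, rfl⟩
      exact (hcomp x).trans (hL hx)) with h | h
  · exact Or.inl fun x hx => (Subgroup.eq_bot_iff_forall _).1 h _ ⟨x, hx, rfl⟩
  · refine Or.inr fun y hy => ?_
    have : y ∈ L.map g.toMonoidHom := by
      rw [h]
      exact hy
    exact this

/-- An open normal `U` that misses some nontrivial element of the kernel must meet the kernel
trivially, by minimality. Then the kernel embeds in the finite group `E/U`. -/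
theorem IsIndecomposable.finite_ker {ζ : E →ₜ* G} (hζ : IsIndecomposable ζ) :
    Finite ζ.toMonoidHom.ker := by
  obtain ⟨x, hx, hx1⟩ := hζ.exists_ker_ne_one
  obtain ⟨U, hU⟩ := ProfiniteGrp.exist_openNormalSubgroup_sub_open_nhds_of_one
    (isOpen_compl_singleton (x := x)) (by simpa using hx1.symm)
  have : Finite (E ⧸ U.toSubgroup) := Subgroup.quotient_finite_of_isOpen U.toSubgroup U.isOpen'
  have : (U.toSubgroup ⊓ ζ.toMonoidHom.ker).Normal := Subgroup.normal_inf_normal _ _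
  rcases hζ.eq_bot_or_eq_ker (U.toSubgroup ⊓ ζ.toMonoidHom.ker)
    ((U.toSubgroup.isClosed_of_isOpen U.isOpen').inter (isClosed_ker ζ)) inf_le_right with h | h
  · refine Finite.of_injective (fun k : ζ.toMonoidHom.ker => (k.1 : E ⧸ U.toSubgroup)) ?_
    rintro ⟨a, ha⟩ ⟨b, hb⟩ hab
    have h1 : a⁻¹ * b ∈ U.toSubgroup ⊓ ζ.toMonoidHom.ker :=
      ⟨QuotientGroup.eq.1 hab, Subgroup.mul_mem _ (Subgroup.inv_mem _ ha) hb⟩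
    rw [h, Subgroup.mem_bot, inv_mul_eq_one] at h1
    exact Subtype.ext h1
  · exfalso
    have h1 : x ∈ U.toSubgroup ⊓ ζ.toMonoidHom.ker := by
      rw [h]
      exact hx
    exact hU h1.1 rfl

theorem IsIndecomposable.discreteTopology_ker {ζ : E →ₜ* G} (hζ : IsIndecomposable ζ) :
    DiscreteTopology ζ.toMonoidHom.ker :=
  have := hζ.finite_ker
  inferInstance

/-- If `ker f ≤ ker g` for two epimorphisms onto indecomposable covers, then `ker f = ker g`. -/
theorem IsIndecomposable.ker_eq_of_le {K : ProfiniteGrp.{u}} {ζ : E →ₜ* G} {η : K →ₜ* G}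
    (hζ : IsIndecomposable ζ) (hη : IsIndecomposable η) {π : H →ₜ* G} (g : H →ₜ* E) (f : H →ₜ* K)
    (hg : Function.Surjective g) (hf : Function.Surjective f) (hgπ : ∀ h, ζ (g h) = π h)
    (hfπ : ∀ h, η (f h) = π h) (hle : ∀ x, f x = 1 → g x = 1) (x : H) : f x = 1 ↔ g x = 1 := by
  refine ⟨hle x, fun hx => ?_⟩
  rcases hη.image_trivial_or_full f hf hfπ g.toMonoidHom.ker (isClosed_ker g) (fun y hy => by
    have hy' : g y = 1 := hy
    change π y = 1
    rw [← hgπ, hy', map_one]) with h | h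
  · exact h x hx
  · exfalso
    -- If `f` maps `ker g` onto `Ker η`, then every `z` in `Ker π` agrees modulo `ker f ≤ ker g`
    -- with some `w` in `ker g`. So `g` kills `Ker π`, although `Ker ζ` is nontrivial.
    obtain ⟨y, hy, hy1⟩ := hζ.exists_ker_ne_one
    obtain ⟨z, rfl⟩ := hg y
    rw [hgπ, ← hfπ] at hy
    obtain ⟨w, hw, hwz⟩ := h _ hy
    have hw' : g w = 1 := hw
    have h1 : f (w⁻¹ * z) = 1 := by rw [map_mul, map_inv, hwz, inv_mul_cancel]
    have h2 := hle _ h1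
    rw [map_mul, map_inv, hw', inv_one, one_mul] at h2
    exact hy1 h2

/-- A maximal element of the closed normal subgroups below `Ker π` gives an indecomposable
cover. -/
theorem isIndecomposable_quotientCover {π : H →ₜ* G} (hπ : Function.Surjective π)
    {N : Subgroup H} (hN : N ∈ maxNormalBelow π.toMonoidHom.ker) [N.Normal]
    (hc : IsClosed (N : Set H)) (hle : N ≤ π.toMonoidHom.ker) :
    IsIndecomposable (H := profiniteQuotient H N hc) (G := G) (quotientCover π N hle) := by
  refine isIndecomposable_of_minimal ?_ ?_ ?_
  · exact quotientCover_surjective hπ N hle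
  · obtain ⟨x, hx, hx1⟩ := SetLike.exists_of_lt hN.1.2.2
    exact ⟨(x : H ⧸ N), hx, fun h => hx1 ((QuotientGroup.eq_one_iff x).1 h)⟩
  · intro M hM hMc hMle
    let q : H →* H ⧸ N := QuotientGroup.mk' N
    let M' : Subgroup H := Subgroup.comap q M
    have hNM : N ≤ M' := fun x hx => by
      change (x : H ⧸ N) ∈ M
      rw [(QuotientGroup.eq_one_iff x).2 hx]
      exact M.one_mem
    have hM'c : IsClosed (M' : Set H) := hMc.preimage continuous_quot_mk
    have hM'le : M' ≤ π.toMonoidHom.ker := fun x hx => hMle hx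
    have hM'n : M'.Normal := Subgroup.Normal.comap hM q
    by_cases h : M' = π.toMonoidHom.ker
    · right
      refine le_antisymm hMle fun y hy => ?_
      obtain ⟨x, rfl⟩ := QuotientGroup.mk_surjective y
      have hx : x ∈ π.toMonoidHom.ker := hy
      rw [← h] at hx
      exact hx
    · left
      have h1 : M' ≤ N := hN.2 ⟨hM'n, hM'c, lt_of_le_of_ne hM'le h⟩ hNM
      refine (Subgroup.eq_bot_iff_forall _).2 fun y hy => ?_
      obtain ⟨x, rfl⟩ := QuotientGroup.mk_surjective y
      exact (QuotientGroup.eq_one_iff x).2 (h1 hy)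

end Indecomposable

/-! ### The dual of the kernel -/

section KerDual

variable {G : Type u} [Group G] [TopologicalSpace G] {E : Type u} [Group E] [TopologicalSpace E]
  {H : Type u} [Group H] [TopologicalSpace H] {η : E →ₜ* G} {π : H →ₜ* G} {A : SimpleGModule G}

theorem kerDual_map_one (φ : kerDual η A) : φ.1 1 = 0 := by
  have h := φ.2.2.1 1 1
  rw [mul_one] at h
  simpa using h

theorem kerDual_map_inv (φ : kerDual η A) (x : η.toMonoidHom.ker) : φ.1 x⁻¹ = -φ.1 x := by
  have h := φ.2.2.1 x⁻¹ x
  rw [inv_mul_cancel, kerDual_map_one] at h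
  exact eq_neg_of_add_eq_zero_left h.symm

/-- The kernel of `φ : Ker η → A`, as a subgroup of `E`. -/
def dualKernel (φ : kerDual η A) : Subgroup E where
  carrier := {x | ∃ hx : η x = 1, φ.1 ⟨x, hx⟩ = 0}
  one_mem' := ⟨map_one η, kerDual_map_one φ⟩
  mul_mem' := by
    rintro x y ⟨hx, hx0⟩ ⟨hy, hy0⟩
    refine ⟨by rw [map_mul, hx, hy, one_mul], ?_⟩
    have h := φ.2.2.1 ⟨x, hx⟩ ⟨y, hy⟩
    rw [hx0, hy0, add_zero] at h
    exact h
  inv_mem' := by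
    rintro x ⟨hx, hx0⟩
    refine ⟨by rw [map_inv, hx, inv_one], ?_⟩
    have h := kerDual_map_inv φ ⟨x, hx⟩
    rw [hx0, neg_zero] at h
    exact h

theorem dualKernel_le (φ : kerDual η A) : dualKernel φ ≤ η.toMonoidHom.ker := fun _ hx => hx.1

instance dualKernel_normal (φ : kerDual η A) : (dualKernel φ).Normal := by
  refine ⟨?_⟩
  rintro x ⟨hx, hx0⟩ h
  refine ⟨by rw [map_mul, map_mul, hx, mul_one, map_inv, mul_inv_cancel], ?_⟩
  have h1 := φ.2.2.2 h ⟨x, hx⟩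
  rw [hx0, smul_zero] at h1
  exact h1

theorem isClosed_dualKernel [T1Space G] (φ : kerDual η A) : IsClosed (dualKernel φ : Set E) := by
  have h : (dualKernel φ : Set E) = Subtype.val '' (φ.1 ⁻¹' {0}) := by
    ext x
    constructor
    · rintro ⟨hx, hx0⟩
      exact ⟨⟨x, hx⟩, hx0, rfl⟩
    · rintro ⟨⟨x, hx⟩, hx0, rfl⟩
      exact ⟨hx, hx0⟩
  rw [h]
  exact (isClosed_ker η).isClosedEmbedding_subtypeVal.isClosedMap _
    ((isClosed_discrete _).preimage φ.2.1)

/-- Since `L` is normal and `η` is onto, the image of `L` under `φ` is a `G`-submodule of the simple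
module `A`. -/
theorem kerDual_image_zero_or_full (hη : Function.Surjective η) (φ : kerDual η A)
    (L : Subgroup E) [hn : L.Normal] (hL : ∀ x ∈ L, η x = 1) :
    (∀ x (hx : x ∈ L), φ.1 ⟨x, hL x hx⟩ = 0) ∨
      ∀ a, ∃ x, ∃ hx : x ∈ L, φ.1 ⟨x, hL x hx⟩ = a := by
  let B : AddSubgroup A :=
    { carrier := {a | ∃ x, ∃ hx : x ∈ L, φ.1 ⟨x, hL x hx⟩ = a}
      zero_mem' := ⟨1, L.one_mem, kerDual_map_one φ⟩
      add_mem' := by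
        rintro _ _ ⟨x, hx, rfl⟩ ⟨y, hy, rfl⟩
        exact ⟨x * y, L.mul_mem hx hy, φ.2.2.1 ⟨x, hL x hx⟩ ⟨y, hL y hy⟩⟩
      neg_mem' := by
        rintro _ ⟨x, hx, rfl⟩
        exact ⟨x⁻¹, L.inv_mem hx, kerDual_map_inv φ ⟨x, hL x hx⟩⟩ }
  rcases A.simple B (by
    rintro g _ ⟨x, hx, rfl⟩
    obtain ⟨h, rfl⟩ := hη g
    exact ⟨h * x * h⁻¹, hn.conj_mem x hx h, φ.2.2.2 h ⟨x, hL x hx⟩⟩) with h | h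
  · left
    intro x hx
    have : φ.1 ⟨x, hL x hx⟩ ∈ B := ⟨x, hx, rfl⟩
    rwa [h, AddSubgroup.mem_bot] at this
  · right
    intro a
    have : a ∈ B := by rw [h]; exact AddSubgroup.mem_top a
    exact this

theorem kerDual_surjective (hη : Function.Surjective η) (φ : kerDual η A) (hφ : φ ≠ 0) :
    Function.Surjective φ.1 := by
  rcases kerDual_image_zero_or_full hη φ η.toMonoidHom.ker (fun _ h => h) with h | h
  · exact absurd (Subtype.ext (funext fun x => h x.1 x.2)) hφ
  · intro a
    obtain ⟨x, hx, hxa⟩ := h a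
    exact ⟨⟨x, hx⟩, hxa⟩

/-- The kernel of an endomorphism is a submodule. If it is trivial, finiteness of `A` gives
surjectivity, and the inverse is again `G`-linear. -/
theorem endG_isUnit_or_eq_zero (α : endG A) : IsUnit α ∨ α = 0 := by
  rcases A.simple (AddMonoidHom.ker (α.1 : A →+ A)) (fun g b hb => by
    have hb' : α.1 b = 0 := hb
    change α.1 (g • b) = 0
    rw [α.2, hb', smul_zero]) with h | h
  · left
    have hinj : Function.Injective α.1 := (AddMonoidHom.ker_eq_bot_iff (α.1 : A →+ A)).1 h
    let e : A ≃+ A := AddEquiv.ofBijective (α.1 : A →+ A) ⟨hinj, Finite.surjective_of_injective hinj⟩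
    let β : endG A := ⟨(e.symm : A →+ A), fun g a => by
      change e.symm (g • a) = g • e.symm a
      rw [AddEquiv.symm_apply_eq]
      change _ = α.1 (g • e.symm a)
      rw [α.2]
      exact congrArg (g • ·) (e.apply_symm_apply a).symm⟩
    refine ⟨⟨α, β, ?_, ?_⟩, rfl⟩
    · exact Subtype.ext (AddMonoidHom.ext fun a => e.apply_symm_apply a)
    · exact Subtype.ext (AddMonoidHom.ext fun a => e.symm_apply_apply a)
  · right
    refine Subtype.ext (AddMonoidHom.ext fun a => ?_)
    have : a ∈ AddMonoidHom.ker (α.1 : A →+ A) := by rw [h]; exact AddSubgroup.mem_top a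
    exact this

instance endG_nontrivial (A : SimpleGModule G) : Nontrivial (endG A) := by
  obtain ⟨a, ha⟩ := exists_ne (0 : A)
  exact ⟨⟨1, 0, fun h => ha (congrArg (fun α : endG A => α.1 a) h)⟩⟩

/-- The ring `End_G(A)` is a division ring, by Schur's lemma. -/
noncomputable abbrev endGDivisionRing (A : SimpleGModule G) : DivisionRing (endG A) :=
  DivisionRing.ofIsUnitOrEqZero endG_isUnit_or_eq_zero

/-- The scalar is `ψ ∘ e⁻¹`: the dual of a kernel isomorphic to `A` is the line spanned by `e`. -/
theorem KerIso.exists_smul_eq (hη : Function.Surjective η) (e : KerIso η A) (ψ : kerDual η A) :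
    ∃ α : endG A, ψ = α • e.1 := by
  let i := Equiv.ofBijective _ e.2
  have hi : ∀ a, e.1.1 (i.symm a) = a := i.apply_symm_apply
  let α : endG A := ⟨AddMonoidHom.mk' (fun a => ψ.1 (i.symm a)) (fun a b => by
      have h : i.symm (a + b) = i.symm a * i.symm b := e.2.1 (by
        rw [e.1.2.2.1, hi, hi, hi])
      rw [h, ψ.2.2.1]), fun g a => by
      obtain ⟨h, rfl⟩ := hη g
      have h1 : i.symm (η h • a) = ⟨h * (i.symm a) * h⁻¹,
          (inferInstance : η.toMonoidHom.ker.Normal).conj_mem _ (i.symm a).2 h⟩ := e.2.1 (by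
        rw [e.1.2.2.2, hi, hi])
      change ψ.1 (i.symm (η h • a)) = η h • ψ.1 (i.symm a)
      rw [h1, ψ.2.2.2]⟩
  refine ⟨α, Subtype.ext (funext fun x => ?_)⟩
  change ψ.1 x = ψ.1 (i.symm (i x))
  rw [i.symm_apply_apply]

/-- The pullback `(Ker η)^* → (Ker π)^*` along a homomorphism over `G`. -/
def kerPull (f : H →ₜ* E) (hf : ∀ h, η (f h) = π h) (A : SimpleGModule G) :
    kerDual η A →ₗ[endG A] kerDual π A where
  toFun φ := ⟨fun x => φ.1 ⟨f x, (hf x).trans x.2⟩,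
    φ.2.1.comp (Continuous.subtype_mk (f.continuous_toFun.comp continuous_subtype_val) _),
    fun x y => by
      rw [← φ.2.2.1]
      exact congrArg φ.1 (Subtype.ext (map_mul f _ _)),
    fun h x => by
      rw [← hf, ← φ.2.2.2]
      exact congrArg φ.1 (Subtype.ext (by simp only [map_mul, map_inv]))⟩
  map_add' _ _ := rfl
  map_smul' _ _ := rfl

theorem kerPull_injective (f : H →ₜ* E) (hf : ∀ h, η (f h) = π h) (hs : Function.Surjective f) :
    Function.Injective (kerPull f hf A) := by
  intro φ ψ h
  refine Subtype.ext (funext ?_)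
  rintro ⟨y, hy⟩
  obtain ⟨x, rfl⟩ := hs y
  exact congrFun (congrArg Subtype.val h) ⟨x, (hf x).symm.trans hy⟩

theorem exists_kerPull_eq [CompactSpace H] [T2Space E] [T1Space G] (f : H →ₜ* E)
    (hf : ∀ h, η (f h) = π h) (hs : Function.Surjective f) (φ : kerDual π A)
    (hφ : ∀ x (hx : π x = 1), f x = 1 → φ.1 ⟨x, hx⟩ = 0) :
    ∃ ψ : kerDual η A, kerPull f hf A ψ = φ := by
  let r : π.toMonoidHom.ker → η.toMonoidHom.ker := fun x => ⟨f x, (hf x).trans x.2⟩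
  have hr : Function.Surjective r := by
    rintro ⟨y, hy⟩
    obtain ⟨x, rfl⟩ := hs y
    exact ⟨⟨x, (hf x).symm.trans hy⟩, rfl⟩
  have hrc : Continuous r :=
    Continuous.subtype_mk (f.continuous_toFun.comp continuous_subtype_val) _
  have hrm : ∀ x y, r (x * y) = r x * r y := fun x y => Subtype.ext (map_mul f _ _)
  have : CompactSpace π.toMonoidHom.ker :=
    isCompact_iff_compactSpace.1 (isClosed_ker π).isCompact
  -- `t` is a bare set-theoretic section of `Ker π → Ker η`. As `φ` is constant on the fibres, `φ ∘
  -- t` is a homomorphism; it is continuous because `r` is a quotient map.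
  choose t ht using id hr
  have key : ∀ x, φ.1 (t (r x)) = φ.1 x := by
    intro x
    have h1 := hφ ((t (r x))⁻¹ * x).1 ((t (r x))⁻¹ * x).2 (by
      have := congrArg Subtype.val (ht (r x))
      change f (t (r x)) = f x at this
      change f ((t (r x)).1⁻¹ * x.1) = 1
      rw [map_mul, map_inv, this, inv_mul_cancel])
    have h2 : φ.1 ((t (r x))⁻¹ * x) = 0 := h1
    rw [φ.2.2.1, kerDual_map_inv] at h2
    rw [eq_comm, ← sub_eq_zero, ← h2]
    abel
  refine ⟨⟨fun y => φ.1 (t y), ?_, fun x y => ?_, ?_⟩, Subtype.ext (funext key)⟩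
  · rw [(hrc.isClosedMap.isQuotientMap hrc hr).continuous_iff]
    exact φ.2.1.congr fun x => (key x).symm
  · obtain ⟨x, rfl⟩ := hr x
    obtain ⟨y, rfl⟩ := hr y
    simp only [key, ← hrm, φ.2.2.1]
  · intro h y
    obtain ⟨h, rfl⟩ := hs h
    obtain ⟨x, rfl⟩ := hr y
    beta_reduce
    rw [hf, key, ← φ.2.2.2]
    refine Eq.trans ?_ (key _)
    refine congrArg (fun z => φ.1 (t z)) (Subtype.ext ?_)
    change f h * f x * (f h)⁻¹ = f (h * x * h⁻¹)
    rw [map_mul, map_mul, map_inv]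

theorem mkQ_eq_mkQ_iff {x y : cocycles2 A} :
    ((coboundaries2 A).submoduleOf (cocycles2 A)).mkQ x =
      ((coboundaries2 A).submoduleOf (cocycles2 A)).mkQ y ↔
    ∃ c : G → A, Continuous c ∧ ∀ σ τ : G,
      x.1 (σ, τ) - y.1 (σ, τ) = σ • c τ - c (σ * τ) + c σ := by
  rw [Submodule.mkQ_apply, Submodule.mkQ_apply, Submodule.Quotient.eq]
  exact Iff.rfl

/-- Replacing a section `u` by `c * u`, for a continuous `c : G → Ker η`. -/
theorem factorSet_mul (φ : kerDual η A) (u v : G → E) (hu : ∀ g, η (u g) = g)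
    (hv : ∀ g, η (v g) = g) (c : G → η.toMonoidHom.ker) (hc : ∀ g, v g = c g * u g) (σ τ : G) :
    φ.1 (factorSet η v hv (σ, τ)) - φ.1 (factorSet η u hu (σ, τ)) =
      σ • φ.1 (c τ) - φ.1 (c (σ * τ)) + φ.1 (c σ) := by
  have h1 : factorSet η v hv (σ, τ) = c σ * ⟨u σ * c τ * (u σ)⁻¹,
      (inferInstance : η.toMonoidHom.ker.Normal).conj_mem _ (c τ).2 (u σ)⟩ *
        factorSet η u hu (σ, τ) * (c (σ * τ))⁻¹ := by
    apply Subtype.ext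
    simp only [factorSet, Subgroup.coe_mul, hc, Subgroup.coe_inv]
    group
  rw [h1, φ.2.2.1, φ.2.2.1, φ.2.2.1, φ.2.2.2, hu, kerDual_map_inv]
  abel

end KerDual

/-! ### Extension classes: naturality and lifting -/

section Extension

variable {G : Type u} [Group G] [TopologicalSpace G] [IsTopologicalGroup G]
  {E : Type u} [Group E] [TopologicalSpace E] [IsTopologicalGroup E]
  {H : Type u} [Group H] [TopologicalSpace H] [IsTopologicalGroup H]
  {η : E →ₜ* G} {π : H →ₜ* G} {A : SimpleGModule G}

/-- The cocycle attached to a section and to `φ : Ker η → A`. -/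
def sectionCocycle (u : G → E) (huc : Continuous u) (hu : ∀ g, η (u g) = g) (φ : kerDual η A) :
    cocycles2 A :=
  ⟨fun p => φ.1 (factorSet η u hu p), comp_factorSet_mem η A u huc hu φ⟩

/-- Two sections differ by a continuous map `c` to the kernel, and the cocycles then differ by the
coboundary of `φ ∘ c`. Any convenient section may therefore replace the chosen one. -/
theorem extMap_eq_of_section (hη : HasContSection η) (u : G → E) (huc : Continuous u)
    (hu : ∀ g, η (u g) = g) (φ : kerDual η A) :
    extMap η hη A φ =
      ((coboundaries2 A).submoduleOf (cocycles2 A)).mkQ (sectionCocycle u huc hu φ) := by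
  let v := hη.choose
  have hv : ∀ g, η (v g) = g := hη.choose_spec.2
  let c : G → η.toMonoidHom.ker := fun g => ⟨v g * (u g)⁻¹, by
    change η _ = 1
    rw [map_mul, map_inv, hu, hv, mul_inv_cancel]⟩
  have hcc : Continuous c :=
    Continuous.subtype_mk (hη.choose_spec.1.mul huc.inv) _
  change ((coboundaries2 A).submoduleOf (cocycles2 A)).mkQ
    (sectionCocycle v hη.choose_spec.1 hv φ) = _
  rw [mkQ_eq_mkQ_iff]
  exact ⟨fun g => φ.1 (c g), φ.2.1.comp hcc, fun σ τ =>
    factorSet_mul φ u v hu hv c (fun g => by simp [c]) σ τ⟩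

/-- If `u` is a section of `π`, then `f ∘ u` is a section of `η`, and `f` maps the one factor set to
the other. -/
theorem extMap_kerPull (hπ : HasContSection π) (hη : HasContSection η) (f : H →ₜ* E)
    (hf : ∀ h, η (f h) = π h) (φ : kerDual η A) :
    extMap π hπ A (kerPull f hf A φ) = extMap η hη A φ := by
  obtain ⟨u, huc, hu⟩ := id hπ
  have hu' : ∀ g, η (f (u g)) = g := fun g => (hf _).trans (hu g)
  rw [extMap_eq_of_section hπ u huc hu, extMap_eq_of_section hη (fun g => f (u g))
    (f.continuous_toFun.comp huc) hu']
  congr 1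
  refine Subtype.ext (funext fun p => ?_)
  refine congrArg φ.1 (Subtype.ext ?_)
  change f (u p.1 * u p.2 * (u (p.1 * p.2))⁻¹) = f (u p.1) * f (u p.2) * (f (u (p.1 * p.2)))⁻¹
  rw [map_mul, map_mul, map_inv]

/-- If `φ : Ker π → A` maps the class of `π` to the class of an extension `η` with kernel
identified with `A`, then `φ` is induced by a homomorphism over `G`. -/
theorem exists_hom_of_extMap_eq (hπ : HasContSection π) (hη : HasContSection η)
    (φ : kerDual π A) (e : KerIso η A) (h : extMap π hπ A φ = extMap η hη A e.1) :
    ∃ (f : H →ₜ* E) (hf : ∀ h, η (f h) = π h), kerPull f hf A e.1 = φ := by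
  obtain ⟨u, huc, hu⟩ := id hπ
  obtain ⟨v, hvc, hv⟩ := id hη
  rw [extMap_eq_of_section hπ u huc hu, extMap_eq_of_section hη v hvc hv, mkQ_eq_mkQ_iff] at h
  obtain ⟨c, hcc, hc⟩ := h
  let i := Equiv.ofBijective _ e.2
  have hi : ∀ a, e.1.1 (i.symm a) = a := i.apply_symm_apply
  have hadd : ∀ a b, i.symm (a + b) = i.symm a * i.symm b := fun a b => e.2.1 (by
    rw [e.1.2.2.1, hi, hi, hi])
  have hsm : ∀ (x : E) a, (i.symm (η x • a) : E) = x * i.symm a * x⁻¹ := fun x a => by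
    have h1 : i.symm (η x • a) = ⟨x * (i.symm a) * x⁻¹,
          (inferInstance : η.toMonoidHom.ker.Normal).conj_mem _ (i.symm a).2 x⟩ := e.2.1 (by
        rw [e.1.2.2.2, hi, hi])
    rw [h1]
  have hker : ∀ a, η (i.symm a) = 1 := fun a => (i.symm a).2
  have hic : Continuous (fun a => (i.symm a : E)) := continuous_of_discreteTopology
  -- The cochain `c` corrects `v` to a section `w` whose cocycle equals that of `u` under `φ`
  -- exactly, not only up to a coboundary.
  let w : G → E := fun g => i.symm (c g) * v g
  have hw : ∀ g, η (w g) = g := fun g => by rw [map_mul, hker, one_mul, hv]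
  have hwc : Continuous w := (hic.comp hcc).mul hvc
  have hfs : ∀ σ τ, φ.1 (factorSet π u hu (σ, τ)) = e.1.1 (factorSet η w hw (σ, τ)) := by
    intro σ τ
    have h1 := factorSet_mul e.1 v w hv hw (fun g => i.symm (c g)) (fun _ => rfl) σ τ
    simp only [hi] at h1
    have h2 := (hc σ τ).trans h1.symm
    exact sub_left_injective h2
  have hw2 : ∀ σ τ, w σ * w τ = i.symm (φ.1 (factorSet π u hu (σ, τ))) * w (σ * τ) := by
    intro σ τ
    rw [hfs, show e.1.1 (factorSet η w hw (σ, τ)) = i (factorSet η w hw (σ, τ)) from rfl,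
      i.symm_apply_apply]
    simp [factorSet]
  -- Every `x` is `k x * u (π x)`, so `f` is defined by applying `e⁻¹ ∘ φ` to the first factor and
  -- replacing `u` by `w` in the second.
  let k : H → π.toMonoidHom.ker := fun x => ⟨x * (u (π x))⁻¹, by
    change π _ = 1
    rw [map_mul, map_inv, hu, mul_inv_cancel]⟩
  have hkc : Continuous k :=
    Continuous.subtype_mk (continuous_id.mul (huc.comp π.continuous_toFun).inv) _
  have hkm : ∀ x y, φ.1 (k (x * y)) =
      φ.1 (k x) + π x • φ.1 (k y) + φ.1 (factorSet π u hu (π x, π y)) := by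
    intro x y
    have h1 : k (x * y) = k x * ⟨u (π x) * k y * (u (π x))⁻¹,
        (inferInstance : π.toMonoidHom.ker.Normal).conj_mem _ (k y).2 (u (π x))⟩ *
          factorSet π u hu (π x, π y) := by
      apply Subtype.ext
      simp only [k, factorSet, Subgroup.coe_mul, map_mul]
      group
    rw [h1, φ.2.2.1, φ.2.2.1, φ.2.2.2, hu]
  let f : H →* E := MonoidHom.mk' (fun x => i.symm (φ.1 (k x)) * w (π x)) (fun x y => by
    have h3 : (i.symm (π x • φ.1 (k y)) : E) = w (π x) * i.symm (φ.1 (k y)) * (w (π x))⁻¹ := by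
      rw [← hsm, hw]
    rw [hkm, hadd, hadd, map_mul, Subgroup.coe_mul, Subgroup.coe_mul, h3, mul_assoc _ _ (w (π x * π y)),
      ← hw2]
    group)
  have hf : ∀ x, η (f x) = π x := fun x => by
    change η (i.symm (φ.1 (k x)) * w (π x)) = π x
    rw [map_mul, hker, hw, one_mul]
  refine ⟨⟨f, (hic.comp (φ.2.1.comp hkc)).mul (hwc.comp π.continuous_toFun)⟩, hf, ?_⟩
  have hmain : ∀ x (hx : π x = 1), f x = i.symm (φ.1 ⟨x, hx⟩) := by
    intro x hx
    -- The sections are not normalized. The cocycle identity at `(1, 1)` shows that `w 1`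
    -- corresponds to `u 1`, and these contributions cancel on `Ker π`.
    have hu1 : π (u 1) = 1 := hu 1
    have hw1 : w 1 = i.symm (φ.1 ⟨u 1, hu1⟩) := by
      have h1 := hw2 1 1
      rw [mul_one, mul_left_inj] at h1
      rw [h1]
      congr 3
      refine congrArg φ.1 (Subtype.ext ?_)
      simp [factorSet]
    change (i.symm (φ.1 (k x)) : E) * w (π x) = _
    rw [hx, hw1, ← Subgroup.coe_mul, ← hadd, ← φ.2.2.1]
    congr 3
    refine congrArg φ.1 (Subtype.ext ?_)
    change x * (u (π x))⁻¹ * u 1 = x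
    rw [hx, inv_mul_cancel_right]
  refine Subtype.ext (funext fun x => ?_)
  have h1 : (⟨f x, (hf x).trans x.2⟩ : η.toMonoidHom.ker) = i.symm (φ.1 x) :=
    Subtype.ext (hmain x.1 x.2)
  change e.1.1 ⟨f x, (hf x).trans x.2⟩ = φ.1 x
  rw [h1, hi]

end Extension

/-! ### Isomorphism classes of simple modules -/

section ModuleIso

variable {G : Type u} [Group G] [TopologicalSpace G] {E : Type u} [Group E] [TopologicalSpace E]
  {η : E →ₜ* G}

/-- Isomorphism of simple `G`-modules. -/
def simpleGModuleSetoid (G : Type u) [Group G] [TopologicalSpace G] :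
    Setoid (SimpleGModule G) where
  r A B := ∃ t : A ≃+ B, ∀ (g : G) (a : A), t (g • a) = g • t a
  iseqv :=
    { refl := fun A => ⟨AddEquiv.refl A, fun _ _ => rfl⟩
      symm := by
        rintro A B ⟨t, ht⟩
        exact ⟨t.symm, fun g b => by rw [AddEquiv.symm_apply_eq, ht, t.apply_symm_apply]⟩
      trans := by
        rintro A B C ⟨t, ht⟩ ⟨s, hs⟩
        exact ⟨t.trans s, fun g a => by simp [ht, hs]⟩ }

/-- The chosen representative of the isomorphism class of a simple `G`-module. -/
noncomputable def moduleRep (A : SimpleGModule G) : SimpleGModule G :=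
  (Quotient.mk (simpleGModuleSetoid G) A).out

theorem moduleRep_rel (A : SimpleGModule G) : (simpleGModuleSetoid G).r (moduleRep A) A :=
  Quotient.exact (s := simpleGModuleSetoid G) (Quotient.out_eq _)

theorem moduleRep_eq_of_rel {A B : SimpleGModule G} (h : (simpleGModuleSetoid G).r A B) :
    moduleRep A = moduleRep B :=
  congrArg Quotient.out (Quotient.sound (s := simpleGModuleSetoid G) h)

theorem KerIso.nonempty_of_rel {A B : SimpleGModule G} (h : (simpleGModuleSetoid G).r A B)
    (e : KerIso η A) : Nonempty (KerIso η B) := by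
  obtain ⟨t, ht⟩ := h
  exact ⟨⟨⟨fun x => t (e.1.1 x),
    (continuous_of_discreteTopology (f := t)).comp e.1.2.1,
    fun x y => (congrArg t (e.1.2.2.1 x y)).trans (map_add t _ _),
    fun h x => (congrArg t (e.1.2.2.2 h x)).trans (ht _ _)⟩, t.bijective.comp e.2⟩⟩

theorem KerIso.rel (hη : Function.Surjective η) {A B : SimpleGModule G} (e : KerIso η A)
    (e' : KerIso η B) : (simpleGModuleSetoid G).r A B := by
  let i := Equiv.ofBijective _ e.2
  let j := Equiv.ofBijective _ e'.2
  have hi : ∀ a, e.1.1 (i.symm a) = a := i.apply_symm_apply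
  refine ⟨⟨i.symm.trans j, fun a b => ?_⟩, fun g a => ?_⟩
  · have h : i.symm (a + b) = i.symm a * i.symm b := e.2.1 (by
      rw [e.1.2.2.1, hi, hi, hi])
    change e'.1.1 (i.symm (a + b)) = e'.1.1 (i.symm a) + e'.1.1 (i.symm b)
    rw [h, e'.1.2.2.1]
  · obtain ⟨h, rfl⟩ := hη g
    have h1 : i.symm (η h • a) = ⟨h * (i.symm a) * h⁻¹,
        (inferInstance : η.toMonoidHom.ker.Normal).conj_mem _ (i.symm a).2 h⟩ := e.2.1 (by
      rw [e.1.2.2.2, hi, hi])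
    change e'.1.1 (i.symm (η h • a)) = η h • e'.1.1 (i.symm a)
    rw [h1, e'.1.2.2.2]

theorem KerIso.ker_comm {A : SimpleGModule G} (e : KerIso η A) :
    ∀ x ∈ η.toMonoidHom.ker, ∀ y ∈ η.toMonoidHom.ker, x * y = y * x := by
  intro x hx y hy
  have h : (⟨x, hx⟩ * ⟨y, hy⟩ : η.toMonoidHom.ker) = ⟨y, hy⟩ * ⟨x, hx⟩ := e.2.1 (by
    rw [e.1.2.2.1, e.1.2.2.1, add_comm])
  exact congrArg Subtype.val h

end ModuleIso

/-! ### Abelian kernels as simple modules, and passage from `B_A` to `Ker π` -/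

section Profinite

variable {G H E : ProfiniteGrp.{u}}

/-- The abelian kernel of an indecomposable epimorphism is a simple module. -/
theorem IsIndecomposable.exists_kerIso {η : E →ₜ* G} (hη : IsIndecomposable η)
    (hab : ∀ x ∈ η.toMonoidHom.ker, ∀ y ∈ η.toMonoidHom.ker, x * y = y * x) :
    ∃ A : SimpleGModule G, Nonempty (KerIso η A) := by
  have := hη.finite_ker
  have := hη.discreteTopology_ker
  obtain ⟨s, hsc, hs⟩ := hasContSection_of_surjective η hη.1
  have hn : η.toMonoidHom.ker.Normal := inferInstance
  let cj : E → η.toMonoidHom.ker → η.toMonoidHom.ker := fun h x =>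
    ⟨h * x * h⁻¹, hn.conj_mem x x.2 h⟩
  -- As the kernel is abelian, conjugation by `h` depends only on `η h`; so the section `s` defines
  -- an action of `G`.
  have hcj : ∀ h h' x, η h = η h' → cj h x = cj h' x := by
    intro h h' x hh
    have h1 : h'⁻¹ * h ∈ η.toMonoidHom.ker := by
      change η _ = 1
      rw [map_mul, map_inv, hh, inv_mul_cancel]
    have h2 := hab _ h1 _ x.2
    apply Subtype.ext
    change h * x * h⁻¹ = h' * x * h'⁻¹
    have h3 : h * x = h' * x * (h'⁻¹ * h) := by
      rw [mul_assoc, ← h2]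
      group
    rw [h3]
    group
  have hmul : ∀ h h' x, cj (h * h') x = cj h (cj h' x) := fun h h' x => Subtype.ext (by
    simp only [cj]
    group)
  have hadd : ∀ h x y, cj h (x * y) = cj h x * cj h y := fun h x y => Subtype.ext (by
    simp only [cj, Subgroup.coe_mul]
    group)
  have hone : ∀ x, cj 1 x = x := fun x => Subtype.ext (by simp [cj])
  let _ : AddCommGroup (Additive η.toMonoidHom.ker) :=
    { (inferInstance : AddGroup (Additive η.toMonoidHom.ker)) with
      add_comm := fun x y => Subtype.ext (hab _ x.2 _ y.2) }
  let _ : DistribMulAction G (Additive η.toMonoidHom.ker) :=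
    { smul := fun g x => cj (s g) x
      one_smul := fun x => (hcj _ _ x (by rw [hs, map_one])).trans (hone x)
      mul_smul := fun g g' x => (hcj _ _ x (by rw [hs, map_mul, hs, hs])).trans (hmul _ _ _)
      smul_zero := fun g => Subtype.ext (by
        change s g * 1 * (s g)⁻¹ = 1
        rw [mul_one, mul_inv_cancel])
      smul_add := fun g x y => hadd _ _ _ }
  let _ : TopologicalSpace (Additive η.toMonoidHom.ker) :=
    inferInstanceAs (TopologicalSpace η.toMonoidHom.ker)
  have : DiscreteTopology (Additive η.toMonoidHom.ker) :=
    inferInstanceAs (DiscreteTopology η.toMonoidHom.ker)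
  have : Finite (Additive η.toMonoidHom.ker) := inferInstanceAs (Finite η.toMonoidHom.ker)
  have : Nontrivial (Additive η.toMonoidHom.ker) := by
    obtain ⟨x, hx, hx1⟩ := hη.exists_ker_ne_one
    exact ⟨⟨(⟨x, hx⟩ : η.toMonoidHom.ker), (1 : η.toMonoidHom.ker),
      fun h => hx1 (congrArg Subtype.val h)⟩⟩
  have : ContinuousSMul G (Additive η.toMonoidHom.ker) := by
    refine ⟨?_⟩
    have h1 : Continuous (fun p : G × η.toMonoidHom.ker => cj (s p.1) p.2) := by
      refine Continuous.subtype_mk ?_ _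
      fun_prop
    exact h1
  let A : SimpleGModule G :=
    { carrier := Additive η.toMonoidHom.ker
      simple := by
        intro B hB
        -- A submodule is a normal subgroup of `E` inside the kernel, closed because it is finite;
        -- simplicity follows from indecomposability.
        let N : Subgroup E :=
          { carrier := {x | ∃ hx : η x = 1, Additive.ofMul (⟨x, hx⟩ : η.toMonoidHom.ker) ∈ B}
            one_mem' := ⟨map_one η, B.zero_mem⟩
            mul_mem' := by
              rintro x y ⟨hx, hxB⟩ ⟨hy, hyB⟩
              exact ⟨by rw [map_mul, hx, hy, one_mul], B.add_mem hxB hyB⟩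
            inv_mem' := by
              rintro x ⟨hx, hxB⟩
              exact ⟨by rw [map_inv, hx, inv_one], B.neg_mem hxB⟩ }
        have hNle : N ≤ η.toMonoidHom.ker := fun x hx => hx.1
        have hNn : N.Normal := by
          refine ⟨?_⟩
          rintro x ⟨hx, hxB⟩ h
          refine ⟨hn.conj_mem x hx h, ?_⟩
          have h1 := hB (η h) _ hxB
          have h2 : cj (s (η h)) ⟨x, hx⟩ = cj h ⟨x, hx⟩ := hcj _ _ _ (hs _)
          change Additive.ofMul (cj (s (η h)) ⟨x, hx⟩) ∈ B at h1
          rw [h2] at h1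
          exact h1
        have hNfin : (N : Set E).Finite :=
          Set.Finite.subset (Set.toFinite (η.toMonoidHom.ker : Set E)) hNle
        rcases hη.eq_bot_or_eq_ker N hNfin.isClosed hNle with h | h
        · left
          refine (AddSubgroup.eq_bot_iff_forall _).2 fun b hb => Subtype.ext ?_
          exact (Subgroup.eq_bot_iff_forall _).1 h (b : η.toMonoidHom.ker).1 ⟨b.2, hb⟩
        · right
          refine (AddSubgroup.eq_top_iff' _).2 fun b => ?_
          have h1 : (b : η.toMonoidHom.ker).1 ∈ N := by
            rw [h]
            exact b.2
          exact h1.2 }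
  refine ⟨A, ⟨⟨⟨fun x => x, continuous_id, fun x y => rfl, fun h x => ?_⟩, Function.bijective_id⟩⟩⟩
  exact (hcj (s (η h)) h x (hs _)).symm

/-- The kernel of `φ` is normal in `E`, so by minimality it is trivial unless `φ = 0`. -/
theorem kerDual_bijective {η : E →ₜ* G} (hη : IsIndecomposable η) {A : SimpleGModule G}
    (φ : kerDual η A) (hφ : φ ≠ 0) : Function.Bijective φ.1 := by
  refine ⟨fun x y hxy => ?_, kerDual_surjective hη.1 φ hφ⟩
  rcases hη.eq_bot_or_eq_ker (dualKernel φ) (isClosed_dualKernel φ) (dualKernel_le φ) with h | h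
  · have h1 : (x⁻¹ * y).1 ∈ dualKernel φ := ⟨(x⁻¹ * y).2, by
      change φ.1 (x⁻¹ * y) = 0
      rw [φ.2.2.1, kerDual_map_inv, hxy, neg_add_cancel]⟩
    rw [h, Subgroup.mem_bot] at h1
    exact inv_mul_eq_one.1 (Subtype.ext h1)
  · refine absurd (Subtype.ext (funext fun x => ?_)) hφ
    have h1 : x.1 ∈ dualKernel φ := by
      rw [h]
      exact x.2
    exact h1.2

variable (π : H →ₜ* G) (A : SimpleGModule G)

/-- The projection `H → H/N` as a continuous homomorphism. -/
def quotientHom (N : Subgroup H) [N.Normal] : H →ₜ* H ⧸ N :=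
  ⟨QuotientGroup.mk' N, continuous_quot_mk⟩

theorem isClosed_moduleKernel : IsClosed (moduleKernel π A : Set H) := by
  have h : IsClosed ((sInf (moduleQuotients π A) : Subgroup H) : Set H) := by
    rw [Subgroup.coe_sInf]
    exact isClosed_biInter fun N hN => hN.2.2.1
  exact (isClosed_ker π).inter h

variable {π A}

/-- A nonzero `φ` is onto `A`, so it induces an isomorphism of `Ker π / Ker φ` with `A`.
Consequently every `φ` vanishes on `N_A`. -/
theorem dualKernel_mem_moduleQuotients (hπ : Function.Surjective π) (φ : kerDual π A)
    (hφ : φ ≠ 0) : dualKernel φ ∈ moduleQuotients π A := by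
  have hc := isClosed_dualKernel φ
  have : IsClosed (dualKernel φ : Set H) := hc
  refine ⟨inferInstance, dualKernel_le φ, hc, ?_⟩
  obtain ⟨ψ, hψ⟩ := exists_kerPull_eq (η := quotientCover π (dualKernel φ) (dualKernel_le φ))
    (quotientHom (dualKernel φ)) (fun _ => rfl) QuotientGroup.mk_surjective φ
    (fun x hx h => ((QuotientGroup.eq_one_iff x).1 h).2)
  refine ⟨⟨ψ, fun x y hxy => ?_, kerDual_surjective (quotientCover_surjective hπ _ _) ψ ?_⟩⟩
  · rw [← inv_mul_eq_one]
    have h1 : ψ.1 (x⁻¹ * y) = 0 := by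
      rw [ψ.2.2.1, kerDual_map_inv, hxy, neg_add_cancel]
    revert h1
    generalize x⁻¹ * y = z
    obtain ⟨z, hz⟩ := z
    obtain ⟨w, rfl⟩ := QuotientGroup.mk_surjective z
    intro h1
    have h2 : φ.1 ⟨w, hz⟩ = 0 := by
      rw [← hψ]
      exact h1
    exact Subtype.ext ((QuotientGroup.eq_one_iff w).2 ⟨hz, h2⟩)
  · rintro rfl
    exact hφ (by rw [← hψ, map_zero])

/-- The dual of `Ker π` is the dual of `B_A = Ker π / N_A`. -/
theorem kerPull_moduleCover_bijective (hπ : Function.Surjective π) :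
    Function.Bijective (kerPull (η := moduleCover π A) (π := π)
      (quotientHom (moduleKernel π A)) (fun _ => rfl) A) := by
  refine ⟨kerPull_injective _ _ QuotientGroup.mk_surjective, fun φ => ?_⟩
  have : IsClosed (moduleKernel π A : Set H) := isClosed_moduleKernel π A
  refine exists_kerPull_eq _ _ QuotientGroup.mk_surjective φ fun x hx h => ?_
  by_cases hφ : φ = 0
  · rw [hφ]
    rfl
  · have h1 := ((QuotientGroup.eq_one_iff x).1 h).2
    exact (Subgroup.mem_sInf.1 h1 _ (dualKernel_mem_moduleQuotients hπ φ hφ)).2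

/-- The map `φ ↦ φ_* f` on the dual of `Ker π`. -/
noncomputable abbrev coverMap (π : H →ₜ* G) (hπ : Function.Surjective π) (A : SimpleGModule G) :
    kerDual π A →ₗ[endG A] H2 A :=
  extMap π (hasContSection_of_surjective π hπ) A

/-- Naturality along `H → H/N_A`. It allows the support and the multiplicity to be computed on the
dual of `Ker π` itself, without `N_A`. -/
theorem moduleMap_eq (hπ : Function.Surjective π) :
    moduleMap π hπ A = coverMap π hπ A ∘ₗ
      (LinearEquiv.ofBijective _ (kerPull_moduleCover_bijective (A := A) hπ)).toLinearMap := by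
  refine LinearMap.ext fun φ => ?_
  exact (extMap_kerPull (η := moduleCover π A) (hasContSection_of_surjective π hπ)
    (hasContSection_moduleCover π hπ A) (quotientHom (moduleKernel π A)) (fun _ => rfl) φ).symm

theorem moduleSupp_eq (hπ : Function.Surjective π) :
    moduleSupp π hπ A = LinearMap.range (coverMap π hπ A) := by
  rw [moduleSupp, moduleMap_eq, LinearMap.range_comp, LinearEquiv.range, Submodule.map_top]

theorem moduleMult_eq (hπ : Function.Surjective π) :
    moduleMult π hπ A = Module.rank (endG A) (LinearMap.ker (coverMap π hπ A)) := by
  rw [moduleMult, moduleMap_eq, LinearMap.ker_comp]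
  exact (LinearEquiv.ofSubmodule' (LinearEquiv.ofBijective _
    (kerPull_moduleCover_bijective (A := A) hπ)) _).rank_eq

end Profinite

/-! ### Lifting a family of vectors to a basis -/

section LinearAlgebra

variable {F W V J : Type u} [DivisionRing F] [AddCommGroup W] [Module F W] [AddCommGroup V]
  [Module F V]

/-- A linear right inverse `r` of `S` splits `w` into `(w - r (S w), S w)`. -/
theorem LinearMap.exists_equiv_ker_prod {R : Type u} [AddCommGroup R] [Module F R]
    (S : W →ₗ[F] R) (hS : LinearMap.range S = ⊤) :
    ∃ t : W ≃ₗ[F] LinearMap.ker S × R, ∀ w, (t w).2 = S w := by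
  obtain ⟨r, hr⟩ := S.exists_rightInverse_of_surjective hS
  have hr' : ∀ x, S (r x) = x := fun x => LinearMap.congr_fun hr x
  refine ⟨LinearEquiv.ofLinearMap
    (LinearMap.prod ((LinearMap.id - r ∘ₗ S).codRestrict _ fun w => by simp [hr']) S)
    (LinearMap.coprod (LinearMap.ker S).subtype r) ?_ ?_, fun w => rfl⟩
  · refine LinearMap.ext fun x => Prod.ext (Subtype.ext ?_) ?_
    · have hx : S x.1.1 = 0 := x.1.2
      simp [hr', hx]
    · have hx : S x.1.1 = 0 := x.1.2
      simp [hr', hx]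
  · ext w
    simp

/-- A family `v` with the span of `v` equal to the range of `S` and as many relations as `S` has
kernel lifts to a basis. -/
theorem exists_basis_of_range_eq (S : W →ₗ[F] V) (v : J → V)
    (hspan : Submodule.span F (Set.range v) = LinearMap.range S)
    (hrank : Module.rank F (LinearMap.ker S) = relationDim F v) :
    ∃ b : Module.Basis J F W, ∀ j, S (b j) = v j := by
  let T : (J →₀ F) →ₗ[F] V := Finsupp.linearCombination F v
  have hT : LinearMap.range T = LinearMap.range S := by
    rw [← hspan, Finsupp.range_linearCombination]
  let T' : (J →₀ F) →ₗ[F] LinearMap.range S := T.codRestrict _ fun x => by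
    rw [← hT]
    exact LinearMap.mem_range_self T x
  have hT' : LinearMap.range T' = ⊤ := by
    rw [LinearMap.range_eq_top]
    rintro ⟨y, hy⟩
    rw [← hT] at hy
    obtain ⟨x, rfl⟩ := hy
    exact ⟨x, rfl⟩
  obtain ⟨t, ht⟩ := S.rangeRestrict.exists_equiv_ker_prod S.range_rangeRestrict
  obtain ⟨t', ht'⟩ := T'.exists_equiv_ker_prod hT'
  have hr : Module.rank F (LinearMap.ker T') = Module.rank F (LinearMap.ker S.rangeRestrict) := by
    rw [LinearMap.ker_codRestrict, LinearMap.ker_rangeRestrict, hrank]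
    rfl
  have : Module.Free F (LinearMap.ker T') := Module.Free.of_divisionRing F (LinearMap.ker T')
  obtain ⟨k⟩ := nonempty_linearEquiv_of_rank_eq hr
  -- Both spaces split as kernel times the common range, and the kernels have equal dimension.
  -- Gluing gives `q` with `S ∘ q = T`, and `q` carries the standard basis to the required one.
  let q : (J →₀ F) ≃ₗ[F] W := t' ≪≫ₗ (k.prodCongr (LinearEquiv.refl F _)) ≪≫ₗ t.symm
  have hq : ∀ x, S (q x) = T x := by
    intro x
    have h1 := ht (q x)
    have h2 : (t (q x)).2 = T' x := by simp [q, ht']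
    rw [h2] at h1
    exact (congrArg Subtype.val h1).symm
  refine ⟨⟨q.symm⟩, fun j => ?_⟩
  change S (q (Finsupp.single j 1)) = v j
  rw [hq]
  simp [T]

/-- The coordinates of `b` identify `S` with the linear combination map of `v`. -/
theorem range_and_rank_of_basis (S : W →ₗ[F] V) (v : J → V) (b : Module.Basis J F W)
    (hb : ∀ j, S (b j) = v j) :
    Submodule.span F (Set.range v) = LinearMap.range S ∧
      Module.rank F (LinearMap.ker S) = relationDim F v := by
  have hv : v = S ∘ b := funext fun j => (hb j).symm
  refine ⟨?_, ?_⟩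
  · rw [hv, Set.range_comp, Submodule.span_image, b.span_eq, Submodule.map_top]
  · have h : Finsupp.linearCombination F v = S ∘ₗ b.repr.symm.toLinearMap := by
      ext j
      simp [hb]
    rw [relationDim, h, LinearMap.ker_comp]
    exact (LinearEquiv.ofSubmodule' b.repr.symm _).rank_eq.symm

end LinearAlgebra

/-! ### Joint kernels, independence and compactness -/

section JointKernel

variable {G H : ProfiniteGrp.{u}} {π : H →ₜ* G} {I : Type u} {K : I → ProfiniteGrp.{u}}
  {η : ∀ i, K i →ₜ* G} {f : ∀ i, H →ₜ* K i}

/-- The intersection of `Ker π` and of the kernels of the `f i`, for `i ∈ J`. -/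
def jointKernel (π : H →ₜ* G) (f : ∀ i, H →ₜ* K i) (J : Set I) : Subgroup H :=
  π.toMonoidHom.ker ⊓ ⨅ i ∈ J, (f i).toMonoidHom.ker

theorem mem_jointKernel {J : Set I} {x : H} :
    x ∈ jointKernel π f J ↔ π x = 1 ∧ ∀ i ∈ J, f i x = 1 := by
  rw [jointKernel, Subgroup.mem_inf]
  simp only [Subgroup.mem_iInf]
  exact Iff.rfl

instance jointKernel_normal (J : Set I) : (jointKernel π f J).Normal := by
  refine ⟨fun x hx h => ?_⟩
  rw [mem_jointKernel] at hx ⊢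
  refine ⟨by simp [hx.1], fun i hi => by simp [hx.2 i hi]⟩

theorem isClosed_jointKernel (J : Set I) : IsClosed (jointKernel π f J : Set H) := by
  rw [jointKernel, Subgroup.coe_inf]
  refine (isClosed_ker π).inter ?_
  simp only [Subgroup.coe_iInf]
  exact isClosed_biInter fun i _ => isClosed_ker (f i)

theorem jointKernel_le (J : Set I) : jointKernel π f J ≤ π.toMonoidHom.ker := inf_le_left

/-- A continuous map from `Ker π` to a discrete space that is trivial on the intersection of all
the kernels is trivial on a finite intersection. -/
theorem exists_finset_of_trivial_on_iInter {X : Type*} [TopologicalSpace X] [DiscreteTopology X]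
    (c : π.toMonoidHom.ker → X) (hc : Continuous c) (x₀ : X)
    (h : ∀ x : π.toMonoidHom.ker, (∀ i, f i x = 1) → c x = x₀) :
    ∃ s : Finset I, ∀ x : π.toMonoidHom.ker, (∀ i ∈ s, f i x = 1) → c x = x₀ := by
  have : CompactSpace π.toMonoidHom.ker :=
    isCompact_iff_compactSpace.1 (isClosed_ker π).isCompact
  have hD : IsCompact (c ⁻¹' {x₀}ᶜ) := ((isClosed_discrete _).preimage hc).isCompact
  obtain ⟨s, hs⟩ := hD.elim_finite_subfamily_closed
    (fun i => {x : π.toMonoidHom.ker | f i x = 1})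
    (fun i => isClosed_singleton.preimage ((f i).continuous_toFun.comp continuous_subtype_val)) (by
      rw [Set.eq_empty_iff_forall_notMem]
      rintro x ⟨hx, hx'⟩
      rw [Set.mem_iInter] at hx'
      exact hx (h x hx'))
  refine ⟨s, fun x hx => ?_⟩
  by_contra hne
  have : x ∈ c ⁻¹' {x₀}ᶜ ∩ ⋂ i ∈ s, {x : π.toMonoidHom.ker | f i x = 1} :=
    ⟨hne, Set.mem_iInter₂.2 hx⟩
  rw [hs] at this
  exact this

/-- An indecomposable quotient with non-abelian kernel that is trivial on a finite intersection of
kernels is trivial on one of them. -/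
theorem IsIndecomposable.exists_of_trivial_on_jointKernel {E : ProfiniteGrp.{u}} {ζ : E →ₜ* G}
    (hζ : IsIndecomposable ζ)
    (hna : ¬ ∀ x ∈ ζ.toMonoidHom.ker, ∀ y ∈ ζ.toMonoidHom.ker, x * y = y * x)
    (g : H →ₜ* E) (hg : Function.Surjective g) (hgπ : ∀ h, ζ (g h) = π h)
    (hf : ∀ i h, η i (f i h) = π h) (s : Finset I)
    (hs : ∀ x ∈ jointKernel π f s, g x = 1) : ∃ i ∈ s, ∀ x, f i x = 1 → g x = 1 := by
  classical
  induction s using Finset.induction_on with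
  | empty =>
    -- The joint kernel of the empty family is `Ker π`; if `g` kills it, then `Ker ζ` is trivial and
    -- hence abelian.
    exfalso
    refine hna fun x hx y hy => ?_
    obtain ⟨z, rfl⟩ := hg x
    have hz : π z = 1 := (hgπ z).symm.trans hx
    rw [hs z (mem_jointKernel.2 ⟨hz, by simp⟩), one_mul, mul_one]
  | insert k s _ ih =>
    have hle : (f k).toMonoidHom.ker ≤ π.toMonoidHom.ker := fun x hx => by
      have hx' : f k x = 1 := hx
      change π x = 1
      rw [← hf k, hx', map_one]
    rcases hζ.image_trivial_or_full g hg hgπ _ (isClosed_jointKernel (π := π) (f := f) s)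
      (jointKernel_le _) with h | h
    · obtain ⟨i, hi, hi'⟩ := ih h
      exact ⟨i, Finset.mem_insert_of_mem hi, hi'⟩
    rcases hζ.image_trivial_or_full g hg hgπ _ (isClosed_ker (f k)) hle with h' | h'
    · exact ⟨k, Finset.mem_insert_self k s, h'⟩
    -- Otherwise both the joint kernel over `s` and `ker (f k)` map onto `Ker ζ`. Commutators of
    -- their elements lie in the joint kernel over `insert k s`, which `g` kills, so `Ker ζ` would
    -- be abelian.
    exfalso
    refine hna fun x hx y hy => ?_
    obtain ⟨a, ha, rfl⟩ := h x hx
    obtain ⟨b, hb, rfl⟩ := h' y hy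
    have hb' : f k b = 1 := hb
    rw [mem_jointKernel] at ha
    have h1 : g (a * b * a⁻¹ * b⁻¹) = 1 := hs _ (mem_jointKernel.2 ⟨by simp [ha.1], by
      intro i hi
      rw [Finset.mem_coe, Finset.mem_insert] at hi
      rcases hi with rfl | hi
      · simp [hb']
      · simp [ha.2 i hi]⟩)
    simp only [map_mul, map_inv] at h1
    rw [mul_inv_eq_one, mul_inv_eq_iff_eq_mul] at h1
    exact h1

variable {A : SimpleGModule G}

/-- An element of `(Ker π)^*` that is trivial on a finite intersection of kernels is a combination
of elements induced from the factors. -/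
theorem mem_span_of_trivial_on_jointKernel (hη : ∀ i, IsIndecomposable (η i))
    (hs : ∀ i, Function.Surjective (f i)) (hf : ∀ i h, η i (f i h) = π h)
    (hπ : Function.Surjective π) (e : ∀ i : kerIndex η A, KerIso (η i) A) (s : Finset I)
    (φ : kerDual π A) (hφ : ∀ x (hx : x ∈ jointKernel π f s), φ.1 ⟨x, jointKernel_le _ hx⟩ = 0) :
    φ ∈ Submodule.span (endG A)
      ((fun i : kerIndex η A => kerPull (f i) (hf i) A (e i).1) '' {i | i.1 ∈ s}) := by
  classical
  induction s using Finset.induction_on generalizing φ with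
  | empty =>
    have : φ = 0 := Subtype.ext (funext fun x => hφ x.1 (mem_jointKernel.2 ⟨x.2, by simp⟩))
    rw [this]
    exact zero_mem _
  | insert k s _ ih =>
    have hmono : Submodule.span (endG A)
        ((fun i : kerIndex η A => kerPull (f i) (hf i) A (e i).1) '' {i | i.1 ∈ s}) ≤
        Submodule.span (endG A)
        ((fun i : kerIndex η A => kerPull (f i) (hf i) A (e i).1) '' {i | i.1 ∈ insert k s}) :=
      Submodule.span_mono (Set.image_mono fun i hi => Finset.mem_insert_of_mem hi)
    rcases kerDual_image_zero_or_full hπ φ (jointKernel π f s) (jointKernel_le _) with h | h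
    · exact hmono (ih φ h)
    have hL : ∀ x ∈ jointKernel π f s, f k x = 1 → x ∈ jointKernel π f (insert k s : Finset I) := by
      intro x hx hx1
      rw [mem_jointKernel] at hx ⊢
      refine ⟨hx.1, fun i hi => ?_⟩
      rw [Finset.mem_coe, Finset.mem_insert] at hi
      rcases hi with rfl | hi
      · exact hx1
      · exact hx.2 i hi
    rcases (hη k).image_trivial_or_full (f k) (hs k) (hf k) _
      (isClosed_jointKernel (π := π) (f := f) s) (jointKernel_le _) with h' | h'
    · exact hmono (ih φ fun x hx => hφ x (hL x hx (h' x hx)))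
    -- On the joint kernel over `s`, which `f k` maps onto `Ker (η k)`, `φ` vanishes where `f k`
    -- does. So there it factors through `f k`, which defines `ψ`.
    choose t ht hft using fun y : (η k).toMonoidHom.ker => h' y.1 y.2
    have key : ∀ x (hx : x ∈ jointKernel π f s) y, f k x = y.1 →
        φ.1 ⟨t y, jointKernel_le _ (ht y)⟩ = φ.1 ⟨x, jointKernel_le _ hx⟩ := by
      intro x hx y hy
      have h1 := hφ ((t y)⁻¹ * x) (hL _ (mul_mem (inv_mem (ht y)) hx) (by
        rw [map_mul, map_inv, hft, hy, inv_mul_cancel]))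
      have h2 := φ.2.2.1 ⟨t y, jointKernel_le _ (ht y)⟩⁻¹ ⟨x, jointKernel_le _ hx⟩
      rw [kerDual_map_inv] at h2
      have h3 := h2.symm.trans h1
      rwa [neg_add_eq_zero] at h3
    have hd := (hη k).discreteTopology_ker
    let ψ : kerDual (η k) A := ⟨fun y => φ.1 ⟨t y, jointKernel_le _ (ht y)⟩,
      continuous_of_discreteTopology, fun x y => by
        beta_reduce
        rw [key _ (mul_mem (ht x) (ht y)) (x * y) (by rw [map_mul, hft, hft]; rfl)]
        exact φ.2.2.1 ⟨t x, _⟩ ⟨t y, _⟩, fun b y => by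
        obtain ⟨b, rfl⟩ := hs k b
        beta_reduce
        rw [key _ ((jointKernel_normal (π := π) (f := f) s).conj_mem _ (ht y) b) _ (by
          rw [map_mul, map_mul, map_inv, hft]), hf]
        exact φ.2.2.2 b ⟨t y, _⟩⟩
    have hψ : ∀ x (hx : x ∈ jointKernel π f s),
        ψ.1 ⟨f k x, (hf k x).trans (jointKernel_le _ hx)⟩ = φ.1 ⟨x, jointKernel_le _ hx⟩ :=
      fun x hx => key x hx _ rfl
    have hψ0 : ψ ≠ 0 := by
      rintro h0
      obtain ⟨a, ha⟩ := exists_ne (0 : A)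
      obtain ⟨x, hx, rfl⟩ := h a
      rw [← hψ x hx, h0] at ha
      exact ha rfl
    let k' : kerIndex η A := ⟨k, ⟨⟨ψ, kerDual_bijective (hη k) ψ hψ0⟩⟩⟩
    obtain ⟨α, hα⟩ := (e k').exists_smul_eq (hη k).1 ψ
    -- Subtracting the part of `φ` that comes from the factor `k` leaves an element trivial on the
    -- joint kernel over `s`, to which induction applies.
    have h1 := ih (φ - α • kerPull (f k) (hf k) A (e k').1) fun x hx => by
      have h2 := hψ x hx
      rw [hα] at h2
      change φ.1 ⟨x, _⟩ - α • (e k').1.1 ⟨f k x, _⟩ = 0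
      rw [← h2]
      exact sub_self _
    have h2 : kerPull (f k) (hf k) A (e k').1 ∈ Submodule.span (endG A)
        ((fun i : kerIndex η A => kerPull (f i) (hf i) A (e i).1) '' {i | i.1 ∈ insert k s}) :=
      Submodule.subset_span ⟨k', Finset.mem_insert_self k s, rfl⟩
    have h3 := add_mem (hmono h1) (Submodule.smul_mem _ α h2)
    rwa [sub_add_cancel] at h3

/-- Evaluation at an element of `Ker π`, as a linear map. -/
def kerEval (π : H →ₜ* G) (A : SimpleGModule G) (x : π.toMonoidHom.ker) :
    kerDual π A →ₗ[endG A] A :=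
  LinearMap.proj x ∘ₗ (kerDual π A).subtype

/-- The dual of the kernel of a fiber product has a basis given by the factors. -/
theorem exists_basis_kerDual (hη : ∀ i, IsIndecomposable (η i))
    (hs : ∀ i, Function.Surjective (f i)) (hf : ∀ i h, η i (f i h) = π h)
    (hπ : Function.Surjective π) (hjoint : ∀ x, π x = 1 → (∀ i, f i x = 1) → x = 1)
    (hfull : ∀ g (k : ∀ i, K i), (∀ i, η i (k i) = g) → ∃ h, π h = g ∧ ∀ i, f i h = k i)
    (e : ∀ i : kerIndex η A, KerIso (η i) A) :
    ∃ b : Module.Basis (kerIndex η A) (endG A) (kerDual π A),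
      ∀ i, b i = kerPull (f i) (hf i) A (e i).1 := by
  classical
  have hli : LinearIndependent (endG A)
      (fun i : kerIndex η A => kerPull (f i) (hf i) A (e i).1) := by
    rw [linearIndependent_iff']
    intro s c hc i hi
    refine Subtype.ext (AddMonoidHom.ext fun a => ?_)
    obtain ⟨y, rfl⟩ := (e i).2.2 a
    -- Evaluating the relation at an element with the single nontrivial coordinate `y` isolates the
    -- coefficient of index `i`.
    obtain ⟨h, hh, hk⟩ := hfull 1 (Pi.mulSingle i.1 y.1) (fun j => by
      by_cases hj : j = i.1
      · subst hj
        rw [Pi.mulSingle_eq_same]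
        exact y.2
      · rw [Pi.mulSingle_eq_of_ne hj, map_one])
    have h1 := congrArg (kerEval π A ⟨h, hh⟩) hc
    rw [map_sum, map_zero, Finset.sum_eq_single_of_mem i hi, map_smul] at h1
    · have h2 : kerEval π A ⟨h, hh⟩ (kerPull (f i) (hf i) A (e i).1) = (e i).1.1 y := by
        refine congrArg (e i).1.1 (Subtype.ext ?_)
        exact (hk i).trans (Pi.mulSingle_eq_same _ _)
      rw [h2] at h1
      exact h1
    · intro j _ hj
      have h2 : kerEval π A ⟨h, hh⟩ (kerPull (f j) (hf j) A (e j).1) = 0 := by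
        refine Eq.trans ?_ (kerDual_map_one (e j).1)
        refine congrArg (e j).1.1 (Subtype.ext ?_)
        exact (hk j).trans (Pi.mulSingle_eq_of_ne (fun h => hj (Subtype.ext h)) _)
      rw [map_smul, h2, smul_zero]
  have hsp : ⊤ ≤ Submodule.span (endG A)
      (Set.range fun i : kerIndex η A => kerPull (f i) (hf i) A (e i).1) := by
    intro φ _
    obtain ⟨s, hφ⟩ := exists_finset_of_trivial_on_iInter (f := f) φ.1 φ.2.1 0 (fun x hx => by
      rw [show x = 1 from Subtype.ext (hjoint x x.2 hx), kerDual_map_one])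
    refine Submodule.span_mono (Set.image_subset_range _ _)
      (mem_span_of_trivial_on_jointKernel hη hs hf hπ e s φ fun x hx => ?_)
    exact hφ ⟨x, jointKernel_le _ hx⟩ (mem_jointKernel.1 hx).2
  exact ⟨Module.Basis.mk hli hsp, fun i => Module.Basis.mk_apply hli hsp i⟩

/-- The factors of a fiber product isomorphic to `ζ` correspond to the quotients isomorphic to
`ζ`. -/
theorem mk_isoOver_eq_coverMult (hη : ∀ i, IsIndecomposable (η i))
    (hs : ∀ i, Function.Surjective (f i)) (hf : ∀ i h, η i (f i h) = π h)
    (hjoint : ∀ x, π x = 1 → (∀ i, f i x = 1) → x = 1)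
    (hfull : ∀ g (k : ∀ i, K i), (∀ i, η i (k i) = g) → ∃ h, π h = g ∧ ∀ i, f i h = k i)
    {E : ProfiniteGrp.{u}} {ζ : E →ₜ* G} (hζ : IsIndecomposable ζ)
    (hna : ¬ ∀ x ∈ ζ.toMonoidHom.ker, ∀ y ∈ ζ.toMonoidHom.ker, x * y = y * x) :
    Cardinal.mk {i : I // IsoOver (η i) ζ} = coverMult π ζ := by
  classical
  refine Cardinal.mk_congr (Equiv.ofBijective
    (fun i => ⟨(f i.1).toMonoidHom.ker, mem_coverQuotients_iff.2 ?_⟩) ⟨?_, ?_⟩)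
  · obtain ⟨t, ht⟩ := i.2
    refine ⟨⟨t.toMulEquiv.toMonoidHom.comp (f i.1).toMonoidHom,
      t.continuous_toFun.comp (f i.1).continuous_toFun⟩, t.surjective.comp (hs i.1),
      fun h => (ht _).trans (hf _ h), ?_⟩
    ext x
    change t (f i.1 x) = 1 ↔ f i.1 x = 1
    rw [← map_one t, t.apply_eq_iff_eq]
  · intro i j hij
    by_contra hne
    obtain ⟨y, hy, hy1⟩ := (hη i.1).exists_ker_ne_one
    -- An element whose only nontrivial coordinate is at `i` lies in `ker (f j)` but not in `ker (f
    -- i)`.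
    obtain ⟨h, hh, hk⟩ := hfull 1 (Pi.mulSingle i.1 y) (fun j => by
      by_cases hj : j = i.1
      · subst hj
        rw [Pi.mulSingle_eq_same]
        exact hy
      · rw [Pi.mulSingle_eq_of_ne hj, map_one])
    have h1 : h ∈ (f j.1).toMonoidHom.ker :=
      (hk j.1).trans (Pi.mulSingle_eq_of_ne (fun h => hne (Subtype.ext h.symm)) _)
    have h3 : (f i.1).toMonoidHom.ker = (f j.1).toMonoidHom.ker := congrArg Subtype.val hij
    rw [← h3] at h1
    have h2 : f i.1 h = 1 := h1
    rw [hk, Pi.mulSingle_eq_same] at h2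
    exact hy1 h2
  · rintro ⟨N, hN⟩
    obtain ⟨g, hg, hgπ, rfl⟩ := mem_coverQuotients_iff.1 hN
    have := hζ.discreteTopology_ker
    obtain ⟨s, hs'⟩ := exists_finset_of_trivial_on_iInter (f := f)
      (fun x : π.toMonoidHom.ker => (⟨g x, (hgπ x).trans x.2⟩ : ζ.toMonoidHom.ker))
      (Continuous.subtype_mk (g.continuous_toFun.comp continuous_subtype_val) _) 1
      (fun x hx => by
        refine Subtype.ext ?_
        change g x = 1
        rw [hjoint x x.2 hx, map_one])
    obtain ⟨i, _, hi⟩ := hζ.exists_of_trivial_on_jointKernel hna g hg hgπ hf s (fun x hx =>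
      congrArg Subtype.val (hs' ⟨x, jointKernel_le _ hx⟩ (mem_jointKernel.1 hx).2))
    have hker := hζ.ker_eq_of_le (hη i) g (f i) hg (hs i) hgπ (hf i) hi
    exact ⟨⟨i, isoOver_of_ker_eq (f i) g (hs i) hg hker fun h => (hf i h).trans (hgπ h).symm⟩,
      Subtype.ext (Subgroup.ext hker)⟩

/-- If no factor is trivial on a finite intersection of the kernels of the others, then the map to
the fiber product is surjective. -/
theorem exists_of_independent (hη : ∀ i, IsIndecomposable (η i))
    (hs : ∀ i, Function.Surjective (f i)) (hf : ∀ i h, η i (f i h) = π h)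
    (hπ : Function.Surjective π)
    (hind : ∀ (s : Finset I) (j : I), j ∉ s → ∃ x ∈ jointKernel π f s, f j x ≠ 1)
    (g : G) (k : ∀ i, K i) (hk : ∀ i, η i (k i) = g) : ∃ h, π h = g ∧ ∀ i, f i h = k i := by
  classical
  have hfin : ∀ s : Finset I, ∃ h, π h = g ∧ ∀ i ∈ s, f i h = k i := by
    intro s
    induction s using Finset.induction_on with
    | empty =>
      obtain ⟨h, hh⟩ := hπ g
      exact ⟨h, hh, by simp⟩
    | insert j s hj ih =>
      obtain ⟨h, hh, hhs⟩ := ih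
      rcases (hη j).image_trivial_or_full (f j) (hs j) (hf j) _
        (isClosed_jointKernel (π := π) (f := f) s) (jointKernel_le _) with h' | h'
      · obtain ⟨x, hx, hx1⟩ := hind s j hj
        exact absurd (h' x hx) hx1
      -- `x` corrects the coordinate `j` and leaves those in `s` unchanged.
      · obtain ⟨x, hx, hxk⟩ := h' ((f j h)⁻¹ * k j) (by
          rw [map_mul, map_inv, hf, hh, hk, inv_mul_cancel])
        rw [mem_jointKernel] at hx
        refine ⟨h * x, by rw [map_mul, hh, hx.1, mul_one], fun i hi => ?_⟩
        rw [Finset.mem_insert] at hi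
        rcases hi with rfl | hi
        · rw [map_mul, hxk, mul_inv_cancel_left]
        · rw [map_mul, hhs i hi, hx.2 i hi, mul_one]
  have hcl : ∀ s : Finset I, IsClosed {h | π h = g ∧ ∀ i ∈ s, f i h = k i} := by
    intro s
    have h1 : {h | π h = g ∧ ∀ i ∈ s, f i h = k i} =
        π ⁻¹' {g} ∩ ⋂ i ∈ s, f i ⁻¹' {k i} := by
      ext
      simp
    rw [h1]
    exact (isClosed_singleton.preimage π.continuous_toFun).inter
      (isClosed_biInter fun i _ => isClosed_singleton.preimage (f i).continuous_toFun)
  obtain ⟨h, hh⟩ := IsCompact.nonempty_iInter_of_directed_nonempty_isCompact_isClosed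
    (fun s : Finset I => {h | π h = g ∧ ∀ i ∈ s, f i h = k i})
    (fun s t => ⟨s ∪ t, fun h hh => ⟨hh.1, fun i hi => hh.2 i (Finset.mem_union_left _ hi)⟩,
      fun h hh => ⟨hh.1, fun i hi => hh.2 i (Finset.mem_union_right _ hi)⟩⟩)
    hfin (fun s => (hcl s).isCompact) hcl
  rw [Set.mem_iInter] at hh
  exact ⟨h, (hh ∅).1, fun i => (hh {i}).2 i (Finset.mem_singleton_self i)⟩

end JointKernel

/-! ### Necessity and sufficiency of the conditions -/

section Classification

variable {G H : ProfiniteGrp.{u}} {π : H →ₜ* G} {I : Type u} {K : I → ProfiniteGrp.{u}}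
  {η : ∀ i, K i →ₜ* G}

theorem IsoOver.ker_comm {H H' G : Type*} [Group H] [TopologicalSpace H] [Group H']
    [TopologicalSpace H'] [Group G] [TopologicalSpace G] {π : H →ₜ* G} {π' : H' →ₜ* G}
    (h : IsoOver π π')
    (hc : ∀ x ∈ π.toMonoidHom.ker, ∀ y ∈ π.toMonoidHom.ker, x * y = y * x) :
    ∀ x ∈ π'.toMonoidHom.ker, ∀ y ∈ π'.toMonoidHom.ker, x * y = y * x := by
  obtain ⟨t, ht⟩ := h.symm
  intro x hx y hy
  apply t.injective
  rw [map_mul, map_mul]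
  exact hc _ ((ht x).trans hx) _ ((ht y).trans hy)

/-- The conditions on the multiplicities are necessary. -/
theorem conditions_of_isoOver (hπ : Function.Surjective π) (hη : ∀ i, IsIndecomposable (η i))
    (e : ∀ (A : SimpleGModule G) (i : kerIndex η A), KerIso (η i) A)
    (h : IsoOver π (fiberProductMap η)) :
    (∀ (E : ProfiniteGrp.{u}) (ζ : E →ₜ* G), IsIndecomposable ζ →
        (¬ ∀ x ∈ ζ.toMonoidHom.ker, ∀ y ∈ ζ.toMonoidHom.ker, x * y = y * x) →
          Cardinal.mk {i : I // IsoOver (η i) ζ} = coverMult π ζ) ∧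
      ∀ A : SimpleGModule G,
        Submodule.span (endG A) (Set.range fun i : kerIndex η A =>
            extClass (η i) (hη i).1 (e A i)) = moduleSupp π hπ A ∧
        moduleMult π hπ A =
          relationDim (endG A) fun i : kerIndex η A => extClass (η i) (hη i).1 (e A i) := by
  classical
  obtain ⟨t, ht⟩ := h
  let f : ∀ i, H →ₜ* K i := fun i =>
    ⟨{ toFun := fun h => (t h).1.2 i
       map_one' := by rw [map_one]; rfl
       map_mul' := fun x y => by rw [map_mul]; rfl },
      (continuous_apply i).comp (continuous_snd.comp
        (continuous_subtype_val.comp t.continuous_toFun))⟩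
  have hf : ∀ i h, η i (f i h) = π h := fun i h => ((t h).2 i).trans (ht h)
  have hfull : ∀ g (k : ∀ i, K i), (∀ i, η i (k i) = g) → ∃ h, π h = g ∧ ∀ i, f i h = k i := by
    intro g k hk
    obtain ⟨h, hh⟩ := t.surjective ⟨(g, k), hk⟩
    refine ⟨h, ?_, fun i => ?_⟩
    · rw [← ht, hh]
      rfl
    · change (t h).1.2 i = k i
      rw [hh]
  have hs : ∀ i, Function.Surjective (f i) := by
    intro i y
    choose k hk using fun j => (hη j).1 (η i y)
    -- The other coordinates are filled with arbitrary preimages of `η i y`.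
    obtain ⟨h, _, hh⟩ := hfull (η i y) (Function.update k i y) (fun j => by
      by_cases hj : j = i
      · subst hj
        rw [Function.update_self]
      · rw [Function.update_of_ne hj, hk])
    exact ⟨h, by rw [hh, Function.update_self]⟩
  have hjoint : ∀ x, π x = 1 → (∀ i, f i x = 1) → x = 1 := by
    intro x hx hx'
    apply t.injective
    rw [map_one]
    exact Subtype.ext (Prod.ext ((ht x).trans hx) (funext hx'))
  refine ⟨fun E ζ hζ hna => mk_isoOver_eq_coverMult hη hs hf hjoint hfull hζ hna, fun A => ?_⟩
  obtain ⟨b, hb⟩ := exists_basis_kerDual hη hs hf hπ hjoint hfull (e A)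
  let _ := endGDivisionRing A
  rw [moduleSupp_eq, moduleMult_eq]
  refine range_and_rank_of_basis (coverMap π hπ A) _ b fun i => ?_
  rw [hb]
  exact extMap_kerPull _ _ (f i) (hf i) (e A i).1

/-- The factors with non-abelian kernel are realized by the quotients of `H` with non-abelian
kernel, bijectively. -/
theorem exists_nonabelian_factors (hη : ∀ i, IsIndecomposable (η i))
    (ha : ∀ (E : ProfiniteGrp.{u}) (ζ : E →ₜ* G), IsIndecomposable ζ →
        (¬ ∀ x ∈ ζ.toMonoidHom.ker, ∀ y ∈ ζ.toMonoidHom.ker, x * y = y * x) →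
          Cardinal.mk {i : I // IsoOver (η i) ζ} = coverMult π ζ) :
    ∃ f : ∀ i : {i : I // ¬ ∀ x ∈ (η i).toMonoidHom.ker, ∀ y ∈ (η i).toMonoidHom.ker,
        x * y = y * x}, H →ₜ* K i,
      (∀ i, Function.Surjective (f i)) ∧ (∀ i h, η i.1 (f i h) = π h) ∧
      (∀ i j, (∀ x, f i x = 1 ↔ f j x = 1) → i = j) ∧
      ∀ (E : ProfiniteGrp.{u}) (ζ : E →ₜ* G), IsIndecomposable ζ →
        (¬ ∀ x ∈ ζ.toMonoidHom.ker, ∀ y ∈ ζ.toMonoidHom.ker, x * y = y * x) →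
        ∀ g : H →ₜ* E, Function.Surjective g → (∀ h, ζ (g h) = π h) →
          ∃ i, ∀ x, f i x = 1 ↔ g x = 1 := by
  let J := {i : I // ¬ ∀ x ∈ (η i).toMonoidHom.ker, ∀ y ∈ (η i).toMonoidHom.ker, x * y = y * x}
  -- Equality of cardinals gives unrelated bijections for isomorphic covers `ζ`. Hence one bijection
  -- `ε q` is fixed per isomorphism class, and `N i` is the quotient that it assigns to `i`.
  let S : Setoid J :=
    { r := fun i j => IsoOver (η i) (η j)
      iseqv := ⟨fun i => IsoOver.refl _, IsoOver.symm, IsoOver.trans⟩ }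
  have hε : ∀ q : Quotient S, Nonempty
      ({i : I // IsoOver (η i) (η q.out.1)} ≃ coverQuotients π (η q.out.1)) := fun q =>
    Cardinal.eq.1 (ha _ _ (hη _) q.out.2)
  have ε := fun q => (hε q).some
  have hout : ∀ i : J, IsoOver (η i.1) (η (Quotient.mk S i).out.1) := fun i =>
    IsoOver.symm (Quotient.mk_out (s := S) i)
  let N : J → Subgroup H := fun i => (ε (Quotient.mk S i) ⟨i.1, hout i⟩).1
  have hN : ∀ i : J, ∃ g : H →ₜ* K i.1, Function.Surjective g ∧ (∀ h, η i.1 (g h) = π h) ∧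
      g.toMonoidHom.ker = N i := by
    intro i
    refine mem_coverQuotients_iff.1 ?_
    obtain ⟨hn, hle, hc, hiso⟩ := (ε (Quotient.mk S i) ⟨i.1, hout i⟩).2
    exact ⟨hn, hle, hc, hiso.trans (hout i).symm⟩
  choose f hs hf hfN using hN
  refine ⟨f, hs, hf, fun i j hij => ?_, fun E ζ hζ hna g hg hgπ => ?_⟩
  · have h1 : Quotient.mk S i = Quotient.mk S j := Quotient.sound (s := S)
      (isoOver_of_ker_eq (f i) (f j) (hs i) (hs j) hij fun h => (hf i h).trans (hf j h).symm)
    have h2 : N i = N j := by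
      rw [← hfN, ← hfN]
      exact Subgroup.ext hij
    have h3 : ∀ (q q' : Quotient S) (a : {i : I // IsoOver (η i) (η q.out.1)})
        (b : {i : I // IsoOver (η i) (η q'.out.1)}), q = q' → (ε q a).1 = (ε q' b).1 →
        a.1 = b.1 := by
      rintro q _ a b rfl h
      exact congrArg Subtype.val ((ε q).injective (Subtype.ext h))
    exact Subtype.ext (h3 _ _ _ _ h1 h2)
  · have h1 : g.toMonoidHom.ker ∈ coverQuotients π ζ := mem_coverQuotients_iff.2 ⟨g, hg, hgπ, rfl⟩
    -- `ker g` is counted by `coverMult π ζ`, so the multiplicity is nonzero and `ζ` occurs among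
    -- the factors.
    have h2 : Nonempty {i : I // IsoOver (η i) ζ} := by
      rw [← Cardinal.mk_ne_zero_iff, ha E ζ hζ hna]
      exact Cardinal.mk_ne_zero_iff.2 ⟨⟨_, h1⟩⟩
    obtain ⟨i, hi⟩ := h2
    let i' : J := ⟨i, fun hc => hna (hi.ker_comm hc)⟩
    let q := Quotient.mk S i'
    have h3 : g.toMonoidHom.ker ∈ coverQuotients π (η q.out.1) := by
      obtain ⟨hn, hle, hc, hiso⟩ := h1
      exact ⟨hn, hle, hc, hiso.trans (hi.symm.trans (hout i'))⟩
    obtain ⟨⟨j, hj⟩, hjq⟩ := (ε q).surjective ⟨_, h3⟩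
    let j' : J := ⟨j, fun hc => q.out.2 (hj.ker_comm hc)⟩
    have h4 : Quotient.mk S j' = q := by
      rw [← Quotient.out_eq q]
      exact Quotient.sound (s := S) hj
    have h5 : ∀ (q q' : Quotient S) (a : {i : I // IsoOver (η i) (η q.out.1)})
        (b : {i : I // IsoOver (η i) (η q'.out.1)}), q = q' → a.1 = b.1 →
        (ε q a).1 = (ε q' b).1 := by
      rintro q _ a b rfl h
      rw [Subtype.ext h]
    have h6 : N j' = g.toMonoidHom.ker :=
      (h5 _ q _ ⟨j, hj⟩ h4 rfl).trans (congrArg Subtype.val hjq)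
    refine ⟨j', fun x => ?_⟩
    rw [← hfN] at h6
    exact SetLike.ext_iff.1 h6 x

/-- A nonzero element of `(Ker π)^*` induced through `f` forces `f` to be surjective. -/
theorem surjective_of_kerPull_ne_zero {E : ProfiniteGrp.{u}} {ζ : E →ₜ* G}
    (hπ : Function.Surjective π) {A : SimpleGModule G} (e : KerIso ζ A) (f : H →ₜ* E)
    (hf : ∀ h, ζ (f h) = π h) (h0 : kerPull f hf A e.1 ≠ 0) : Function.Surjective f := by
  intro y
  obtain ⟨x, hx⟩ := hπ (ζ y)
  have h1 : ζ ((f x)⁻¹ * y) = 1 := by rw [map_mul, map_inv, hf, hx, inv_mul_cancel]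
  -- Already `e ∘ f` maps `Ker π` onto `A`, so `f` maps `Ker π` onto `Ker ζ`.
  obtain ⟨z, hz⟩ := kerDual_surjective hπ _ h0 (e.1.1 ⟨_, h1⟩)
  have h2 := congrArg Subtype.val (e.2.1 hz)
  change f z = (f x)⁻¹ * y at h2
  exact ⟨x * z, by rw [map_mul, h2, mul_inv_cancel_left]⟩

/-- Isomorphic modules have the same factors but separately chosen bases of their duals. Restricting
to one representative per class makes the choice of the lifts `f i` unambiguous. -/
theorem exists_kerIso_moduleRep {E : ProfiniteGrp.{u}} {ζ : E →ₜ* G} (hζ : IsIndecomposable ζ)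
    (hc : ∀ x ∈ ζ.toMonoidHom.ker, ∀ y ∈ ζ.toMonoidHom.ker, x * y = y * x) :
    ∃ A : SimpleGModule G, moduleRep A = A ∧ Nonempty (KerIso ζ A) := by
  obtain ⟨A, ⟨e⟩⟩ := hζ.exists_kerIso hc
  exact ⟨moduleRep A, moduleRep_eq_of_rel (moduleRep_rel A),
    e.nonempty_of_rel ((simpleGModuleSetoid G).symm (moduleRep_rel A))⟩

/-- The conditions on the multiplicities are sufficient. -/
theorem isoOver_of_conditions (hπ : IsFundamental π) (hη : ∀ i, IsIndecomposable (η i))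
    (e : ∀ (A : SimpleGModule G) (i : kerIndex η A), KerIso (η i) A)
    (ha : ∀ (E : ProfiniteGrp.{u}) (ζ : E →ₜ* G), IsIndecomposable ζ →
        (¬ ∀ x ∈ ζ.toMonoidHom.ker, ∀ y ∈ ζ.toMonoidHom.ker, x * y = y * x) →
          Cardinal.mk {i : I // IsoOver (η i) ζ} = coverMult π ζ)
    (hb : ∀ A : SimpleGModule G,
        Submodule.span (endG A) (Set.range fun i : kerIndex η A =>
            extClass (η i) (hη i).1 (e A i)) = moduleSupp π hπ.1 A)
    (hc : ∀ A : SimpleGModule G, moduleMult π hπ.1 A =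
          relationDim (endG A) fun i : kerIndex η A => extClass (η i) (hη i).1 (e A i)) :
    IsoOver π (fiberProductMap η) := by
  obtain ⟨f₀, hs₀, hf₀, hinj₀, hall₀⟩ := exists_nonabelian_factors hη ha
  have hbasis : ∀ A : SimpleGModule G, ∃ b : Module.Basis (kerIndex η A) (endG A) (kerDual π A),
      ∀ i, coverMap π hπ.1 A (b i) = extClass (η i) (hη i).1 (e A i) := by
    intro A
    let _ := endGDivisionRing A
    refine exists_basis_of_range_eq (coverMap π hπ.1 A) _ ?_ ?_
    · rw [hb, moduleSupp_eq]
    · rw [← moduleMult_eq, hc]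
  choose b hbS using hbasis
  -- A non-abelian factor takes its map from `f₀`; an abelian one lifts the basis vector of its
  -- representative module, which is possible because this vector is sent to the class of `η i`.
  have hfex : ∀ i, ∃ (f : H →ₜ* K i) (hf : ∀ h, η i (f h) = π h), Function.Surjective f ∧
      (∀ A, moduleRep A = A → ∀ h : Nonempty (KerIso (η i) A),
        kerPull f hf A (e A ⟨i, h⟩).1 = b A ⟨i, h⟩) ∧ ∀ hna, f = f₀ ⟨i, hna⟩ := by
    intro i
    by_cases hab : ∀ x ∈ (η i).toMonoidHom.ker, ∀ y ∈ (η i).toMonoidHom.ker, x * y = y * x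
    · obtain ⟨A, hA, hiA⟩ := exists_kerIso_moduleRep (hη i) hab
      obtain ⟨f, hf, hfb⟩ := exists_hom_of_extMap_eq (hasContSection_of_surjective π hπ.1)
        (hasContSection_of_surjective (η i) (hη i).1) (b A ⟨i, hiA⟩) (e A ⟨i, hiA⟩) (hbS A ⟨i, hiA⟩)
      refine ⟨f, hf, ?_, ?_, fun hna => absurd hab hna⟩
      · refine surjective_of_kerPull_ne_zero hπ.1 (e A ⟨i, hiA⟩) f hf ?_
        rw [hfb]
        exact (b A).ne_zero _
      · rintro A' hA' ⟨e'⟩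
        have h1 : A = A' := by
          rw [← hA, ← hA']
          exact moduleRep_eq_of_rel ((e A ⟨i, hiA⟩).rel (hη i).1 e')
        subst h1
        exact hfb
    · exact ⟨f₀ ⟨i, hab⟩, hf₀ ⟨i, hab⟩, hs₀ _, fun A _ ⟨e'⟩ => absurd e'.ker_comm hab, fun _ => rfl⟩
  choose f hf hs hfb hf0 using hfex
  -- Independence: a dependence would put `b j` in the span of other basis vectors in the abelian
  -- case. In the non-abelian case it would give two indices the same kernel.
  have hind : ∀ (s : Finset I) (j : I), j ∉ s → ∃ x ∈ jointKernel π f s, f j x ≠ 1 := by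
    intro s j hj
    by_contra! hcon
    by_cases hab : ∀ x ∈ (η j).toMonoidHom.ker, ∀ y ∈ (η j).toMonoidHom.ker, x * y = y * x
    · obtain ⟨A, hA, hjA⟩ := exists_kerIso_moduleRep (hη j) hab
      have h1 := mem_span_of_trivial_on_jointKernel hη hs hf hπ.1 (e A) s (b A ⟨j, hjA⟩)
        (fun x hx => by
          rw [← hfb j A hA hjA]
          refine Eq.trans ?_ (kerDual_map_one (e A ⟨j, hjA⟩).1)
          exact congrArg (e A ⟨j, hjA⟩).1.1 (Subtype.ext (hcon x hx)))
      have h2 : (fun i : kerIndex η A => kerPull (f i) (hf i) A (e A i).1) = b A :=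
        funext fun i => hfb i.1 A hA i.2
      rw [h2] at h1
      exact (b A).linearIndependent.notMem_span_image hj h1
    · obtain ⟨i, hi, hij⟩ := (hη j).exists_of_trivial_on_jointKernel hab (f j) (hs j) (hf j) hf s
        hcon
      have hker := (hη j).ker_eq_of_le (hη i) (f j) (f i) (hs j) (hs i) (hf j) (hf i) hij
      have hiso := isoOver_of_ker_eq (f i) (f j) (hs i) (hs j) hker
        fun h => (hf i h).trans (hf j h).symm
      have hab' := fun h => hab (hiso.ker_comm h)
      have h1 := hinj₀ ⟨i, hab'⟩ ⟨j, hab⟩ (fun x => by rw [← hf0 i hab', ← hf0 j hab, hker])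
      have h2 : i = j := congrArg Subtype.val h1
      exact hj (h2 ▸ hi)
  -- An `x` killed by all `f i` lies in every maximal `N`. If `H/N → G` has abelian kernel, `N` is
  -- cut out in `Ker π` by an element of the dual, a combination of basis vectors vanishing at `x`;
  -- otherwise `N` is the kernel of some `f i`.
  have hjoint : ∀ x, π x = 1 → (∀ i, f i x = 1) → x = 1 := by
    intro x hx hxf
    have h1 : x ∈ fundamentKernel π := by
      refine ⟨hx, Subgroup.mem_sInf.2 fun N hN => ?_⟩
      obtain ⟨hn, hcl, hlt⟩ := hN.1
      have hind := isIndecomposable_quotientCover hπ.1 hN hcl hlt.le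
      by_cases hab : ∀ x ∈ (quotientCover π N hlt.le).toMonoidHom.ker,
          ∀ y ∈ (quotientCover π N hlt.le).toMonoidHom.ker, x * y = y * x
      · obtain ⟨A, hA, ⟨e'⟩⟩ := exists_kerIso_moduleRep hind hab
        have h2 : ∀ φ : kerDual π A, φ.1 ⟨x, hx⟩ = 0 := by
          intro φ
          have h3 : kerEval π A ⟨x, hx⟩ = 0 := (b A).ext fun i => by
            rw [← hfb i.1 A hA i.2]
            refine Eq.trans ?_ (kerDual_map_one (e A i).1)
            exact congrArg (e A i).1.1 (Subtype.ext (hxf i))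
          exact LinearMap.congr_fun h3 φ
        have h4 := h2 (kerPull (η := quotientCover π N hlt.le) (quotientHom N) (fun _ => rfl) A e'.1)
        have h5 := e'.2.1 (h4.trans (kerDual_map_one e'.1).symm)
        exact (QuotientGroup.eq_one_iff x).1 (congrArg Subtype.val h5)
      · obtain ⟨i, hi⟩ := hall₀ _ _ hind hab (quotientHom N) QuotientGroup.mk_surjective
          (fun _ => rfl)
        have h2 := (hi x).1 (by rw [← hf0 i.1 i.2]; exact hxf i.1)
        exact (QuotientGroup.eq_one_iff x).1 h2
    rw [hπ.2] at h1
    exact h1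
  have hfull := exists_of_independent hη hs hf hπ.1 hind
  let F : H →ₜ* fiberProduct η :=
    ⟨{ toFun := fun h => ⟨(π h, fun i => f i h), fun i => hf i h⟩
       map_one' := Subtype.ext (Prod.ext (map_one π) (funext fun i => map_one (f i)))
       map_mul' := fun x y =>
        Subtype.ext (Prod.ext (map_mul π x y) (funext fun i => map_mul (f i) x y)) },
      Continuous.subtype_mk (π.continuous_toFun.prodMk
        (continuous_pi fun i => (f i).continuous_toFun)) _⟩
  refine isoOver_of_ker_eq (ContinuousMonoidHom.id H) F Function.surjective_id ?_ (fun x => ?_)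
    fun _ => rfl
  · rintro ⟨⟨g, k⟩, hk⟩
    obtain ⟨h, hh, hhk⟩ := hfull g k hk
    exact ⟨h, Subtype.ext (Prod.ext hh (funext hhk))⟩
  · refine ⟨fun h => ?_, fun h => ?_⟩
    · have h' : x = 1 := h
      rw [h', map_one]
    · have h1 := congrArg Subtype.val h
      exact hjoint x (congrArg Prod.fst h1) fun i => congrFun (congrArg Prod.snd h1) i

end Classification

theorem mainTheorem5 {G H : ProfiniteGrp.{u}} (π : H →ₜ* G) (hπ : IsFundamental π)
    {I : Type u} {K : I → ProfiniteGrp.{u}} (η : ∀ i, K i →ₜ* G)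
    (hη : ∀ i, IsIndecomposable (η i))
    -- identifications of the abelian kernels with the simple modules isomorphic to them
    (e : ∀ (A : SimpleGModule G) (i : kerIndex η A), KerIso (η i) A) :
    IsoOver π (fiberProductMap η) ↔
      (∀ (E : ProfiniteGrp.{u}) (ζ : E →ₜ* G), IsIndecomposable ζ →
        (¬ ∀ x ∈ ζ.toMonoidHom.ker, ∀ y ∈ ζ.toMonoidHom.ker, x * y = y * x) →
          Cardinal.mk {i : I // IsoOver (η i) ζ} = coverMult π ζ) ∧
      (∀ A : SimpleGModule G,
        Submodule.span (endG A) (Set.range fun i : kerIndex η A =>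
            extClass (η i) (hη i).1 (e A i)) =
          moduleSupp π hπ.1 A) ∧
      (∀ A : SimpleGModule G,
        moduleMult π hπ.1 A =
          relationDim (endG A) fun i : kerIndex η A =>
            extClass (η i) (hη i).1 (e A i)) := by
  refine ⟨fun h => ?_, fun ⟨ha, hb, hc⟩ => isoOver_of_conditions hπ hη e ha hb hc⟩
  obtain ⟨h1, h2⟩ := conditions_of_isoOver hπ.1 hη e h
  exact ⟨h1, fun A => (h2 A).1, fun A => (h2 A).2⟩
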